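/- **Theorem 3.** Let $n\ge 1$ be an integer, and let $sl(n,\mathbb C)$ be the Lie algebra of traceless complex $n\times n$ matrices. An automorphism of $sl(n,\mathbb C)$ is *inner* if it has the form $X\mapsto AXA^{-1}$ with $A\in SL(n,\mathbb C)$, and *outer* otherwise. An automorphism $g$ with $g^2=\mathrm{Id}$ gives the $\mathbb Z_2$-grading $L_0=\{X: g(X)=X\}$, $L_1=\{X: g(X)=-X\}$. A representation $r$ on $V$ is *compatible* with it if $V=V_0\oplus V_1$ with $r(X)V_j\subseteq V_{i+j}$ for all $i,j\in\mathbb Z_2$ and $X\in L_i$ (the summands may be zero). It is *self-contragredient* if it is equivalent to the dual representation on $V^*$. A *simulation matrix* of $g$ for $r$ is an operator $R$ with $R^2=\mathrm{Id}$ and $r(g(X))=R\,r(X)\,R^{-1}$ for all $X$. Let $r$ be an irreducible finite-dimensional complex representation of $sl(n,\mathbb C)$ on $V$. 1. For every outer automorphism $g$ of order $2$, the $\mathbb Z_2$-grading given by $g$ is compatible with $r$ if and only if $r$ is self-contragredient. The same holds for $g=\mathrm{Out}_I: X\mapsto -X^T$, for every $n$. 2. For integers $m_{1,n}\ge\dots\ge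 m_{n,n}=0$ let $r(m)$ denote the Gel'fand–Tseitlin action on the space with basis $\xi(\mathbf m)$, where $\mathbf m=(m_{i,j})_{1\le i\le j\le n}$ runs over the integer patterns with top row $m$ and $m_{i,j+1}\ge m_{i,j}\ge m_{i+1,j+1}$. Put $r_k=\sum_{i\le k}m_{i,k}$, $r_0=0$. The action is $$E_{k,k}\,\xi(\mathbf m)=(r_k-r_{k-1})\xi(\mathbf m),\quad E_{k+1,k}\,\xi(\mathbf m)=\sum_{j=1}^k a_k^j\,\xi(\mathbf m-\delta_{j,k}),\quad E_{k,k+1}\,\xi(\mathbf m)=\sum_{j=1}^k b_k^j\,\xi(\mathbf m+\delta_{j,k}),$$ $$a_k^j=\left[-\frac{\prod_{i=1}^{k+1}(m_{i,k+1}-m_{j,k}-i+j+1)\prod_{i=1}^{k-1}(m_{i,k-1}-m_{j,k}-i+j)}{\prod_{i\ne j}(m_{i,k}-m_{j,k}-i+j+1)(m_{i,k}-m_{j,k}-i+j)}\right]^{1/2},$$ $$b_k^j=\left[-\frac{\prod_{i=1}^{k+1}(m_{i,k+1}-m_{j,k}-i+j)\prod_{i=1}^{k-1}(m_{i,k-1}-m_{j,k}-i+j-1)}{\prod_{i\ne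 j}(m_{i,k}-m_{j,k}-i+j)(m_{i,k}-m_{j,k}-i+j-1)}\right]^{1/2},$$ where $\mathbf m\pm\delta_{j,k}$ has the entry $m_{j,k}$ changed by $\pm1$ and terms in which this is not a pattern are omitted; the other $E_{k,l}$ act by iterated commutators $E_{k,l+1}=[E_{k,l},E_{l,l+1}]$ for $k<l$ and $E_{l+1,k}=[E_{l+1,l},E_{l,k}]$ for $l>k$, and $X=\sum X_{kl}E_{kl}$ acts linearly. Put $m'_{i,j}=m_{1,n}-m_{j-i+1,j}$, and write $m'$ for the top row of $\mathbf m'$. Then the linear map $$J\,\xi(\mathbf m)=(-1)^{\sum_{i,j}m_{i,j}}\,\xi(\mathbf m')$$ from the space of $r(m)$ to that of $r(m')$ is bijective and satisfies $J\,r(m)(X)=r(m')(-X^T)\,J$ for all $X\in sl(n,\mathbb C)$. 3. If $m'=m$, then $J^2=\varepsilon\,\mathrm{Id}$ with $\varepsilon=(-1)^{m_{1,n}n(n+1)/2}$, and for each $c\in\mathbb C$ with $c^2=\varepsilon$ the operator $cJ$ is a simulation matrix of $\mathrm{Out}_I$ for $r(m)$; in particular $J$ itself is one if $\varepsilon=1$.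 4. If $r$ is equivalent to $r(m)$ by a linear isomorphism $\varphi$ of $V$ onto the space of $r(m)$, then $r$ is self-contragredient if and only if $m'=m$, and in that case $\varphi^{-1}(cJ)\varphi$, with $c^2=\varepsilon$, is a simulation matrix of $\mathrm{Out}_I$ for $r$. -/

import Mathlib

noncomputable section

namespace SlGrading

/-- `sl(n, ℂ)`: complex `n × n` matrices of trace zero, with the commutator bracket. -/
abbrev SL (n : ℕ) : Type := LieAlgebra.SpecialLinear.sl (Fin n) ℂ

/-! ### Automorphisms of `sl(n, ℂ)` and their gradings -/

/-- The automorphism `X ↦ -Xᵀ` of `sl(n, ℂ)`. -/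
def outI (n : ℕ) : SL n ≃ₗ⁅ℂ⁆ SL n where
  toFun X := ⟨-X.val.transpose, by
    have h : X.val.trace = 0 := X.property
    change Matrix.trace (-X.val.transpose) = 0
    simp [h]⟩
  map_add' X Y := by
    apply Subtype.ext
    change -(X.val + Y.val).transpose = -X.val.transpose + -Y.val.transpose
    rw [Matrix.transpose_add, neg_add]
  map_smul' c X := by
    apply Subtype.ext
    change -(c • X.val).transpose = c • (-X.val.transpose)
    rw [Matrix.transpose_smul, smul_neg]
  map_lie' := by
    intro X Y
    apply Subtype.ext
    change -(X.val * Y.val - Y.val * X.val).transpose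
      = (-X.val.transpose) * (-Y.val.transpose) - (-Y.val.transpose) * (-X.val.transpose)
    rw [Matrix.transpose_sub, Matrix.transpose_mul, Matrix.transpose_mul]
    simp
  invFun X := ⟨-X.val.transpose, by
    have h : X.val.trace = 0 := X.property
    change Matrix.trace (-X.val.transpose) = 0
    simp [h]⟩
  left_inv X := by
    apply Subtype.ext
    change -(-X.val.transpose).transpose = X.val
    simp
  right_inv X := by
    apply Subtype.ext
    change -(-X.val.transpose).transpose = X.val
    simp

/-- `g` is inner: `g = Ad_A`, `X ↦ A X A⁻¹`, for some `A` in the group `SL(n, ℂ)`. -/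
def IsInner {n : ℕ} (g : SL n ≃ₗ⁅ℂ⁆ SL n) : Prop :=
  ∃ A : Matrix.SpecialLinearGroup (Fin n) ℂ, ∀ X : SL n,
    (g X).val = (A : Matrix (Fin n) (Fin n) ℂ) * X.val *
      ((A⁻¹ : Matrix.SpecialLinearGroup (Fin n) ℂ) : Matrix (Fin n) (Fin n) ℂ)

/-- `g` is outer: it is not inner. -/
def IsOuter {n : ℕ} (g : SL n ≃ₗ⁅ℂ⁆ SL n) : Prop := ¬ IsInner g

/-- `g` has order exactly two. -/
def HasOrderTwo {L : Type*} [LieRing L] [LieAlgebra ℂ L] (g : L ≃ₗ⁅ℂ⁆ L) : Prop :=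
  g ≠ LieEquiv.refl ∧ g.trans g = LieEquiv.refl

/-- The `ℤ₂`-grading given by an automorphism of order two: `L₀` and `L₁` are the eigenspaces
of `g` for the eigenvalues `1` and `-1`. -/
def z2Grading {L : Type*} [LieRing L] [LieAlgebra ℂ L] (g : L ≃ₗ⁅ℂ⁆ L) :
    ZMod 2 → Submodule ℂ L :=
  fun i => Module.End.eigenspace (g.toLinearEquiv : L →ₗ[ℂ] L) (if i = 0 then 1 else -1)

/-- The representation `V` of `L` is compatible with the `G`-grading `Γ` of `L`:
`V = ⨁ V_j` with `L_i V_j ⊆ V_{i+j}`. -/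
def Compatible {G L : Type*} [Add G] [DecidableEq G] [LieRing L] [LieAlgebra ℂ L]
    (Γ : G → Submodule ℂ L) (V : Type*) [AddCommGroup V] [Module ℂ V] [LieRingModule L V] :
    Prop :=
  ∃ W : G → Submodule ℂ V, DirectSum.IsInternal W ∧
    ∀ i j : G, ∀ x ∈ Γ i, ∀ v ∈ W j, ⁅x, v⁆ ∈ W (i + j)

/-- The representation `V` is equivalent to its dual (contragredient) representation. -/
def SelfContragredient (L V : Type*) [LieRing L] [LieAlgebra ℂ L] [AddCommGroup V] [Module ℂ V]
    [LieRingModule L V] [LieModule ℂ L V] : Prop :=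
  Nonempty (V ≃ₗ⁅ℂ, L⁆ Module.Dual ℂ V)

/-- `R` is a simulation matrix of the automorphism `g` of order two, for operators `ρ x`
representing the elements `x` of `L`: `ρ (g x) = R (ρ x) R⁻¹` for all `x`, and `R² = 1`. -/
def IsSimulationMatrix {L W : Type*} [LieRing L] [LieAlgebra ℂ L] [AddCommGroup W] [Module ℂ W]
    (ρ : L → Module.End ℂ W) (g : L ≃ₗ⁅ℂ⁆ L) (R : Module.End ℂ W) : Prop :=
  R ^ 2 = 1 ∧ ∀ x : L, ρ (g x) * R = R * ρ x

/-! ### Gel'fand–Tseitlin patterns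

Indices are 1-based natural numbers; entries outside the index range are `0`. -/

/-- The `n`-tuples of integers `m₁ ≥ m₂ ≥ … ≥ mₙ = 0`. -/
@[ext]
structure TopRow (n : ℕ) where
  row : ℕ → ℤ
  row_eq_zero : ∀ i, ¬ (1 ≤ i ∧ i ≤ n) → row i = 0
  row_succ_le : ∀ i, 1 ≤ i → i + 1 ≤ n → row (i + 1) ≤ row i
  row_last : row n = 0

/-- The `n`-tuple `m'ᵢ = m₁ - m_{n-i+1}`. -/
def TopRow.contra {n : ℕ} (m : TopRow n) : TopRow n where
  row i := if 1 ≤ i ∧ i ≤ n then m.row 1 - m.row (n + 1 - i) else 0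
  row_eq_zero i hi := if_neg hi
  row_succ_le i h1 h2 := by
    rw [if_pos ⟨by omega, h2⟩, if_pos ⟨h1, by omega⟩]
    have h := m.row_succ_le (n + 1 - (i + 1)) (by omega) (by omega)
    rw [show n + 1 - (i + 1) + 1 = n + 1 - i by omega] at h
    omega
  row_last := by
    split_ifs with h
    · rw [show n + 1 - n = 1 by omega, sub_self]
    · rfl

/-- `e i j` (`1 ≤ i ≤ j ≤ n`) are the entries of a triangular pattern with top row `m`. -/
structure IsPattern {n : ℕ} (m : TopRow n) (e : ℕ → ℕ → ℤ) : Prop where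
  eq_zero : ∀ i j, ¬ (1 ≤ i ∧ i ≤ j ∧ j ≤ n) → e i j = 0
  top : ∀ i, 1 ≤ i → i ≤ n → e i n = m.row i
  le_left : ∀ i j, 1 ≤ i → i ≤ j → j + 1 ≤ n → e i j ≤ e i (j + 1)
  right_le : ∀ i j, 1 ≤ i → i ≤ j → j + 1 ≤ n → e (i + 1) (j + 1) ≤ e i j

/-- Triangular patterns with top row `m`. -/
abbrev Pattern {n : ℕ} (m : TopRow n) : Type := {e : ℕ → ℕ → ℤ // IsPattern m e}

/-- The representation space with basis `ξ(𝐦)`, `𝐦` a pattern with top row `m`. -/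
abbrev GTSpace {n : ℕ} (m : TopRow n) : Type := Pattern m →₀ ℂ

open Classical in
/-- The vector `ξ(e)`, read as `0` if `e` is not a pattern. -/
def xi {n : ℕ} (m : TopRow n) (e : ℕ → ℕ → ℤ) : GTSpace m :=
  if h : IsPattern m e then Finsupp.single ⟨e, h⟩ 1 else 0

/-- The array obtained from `e` by adding `d` to the entry `e j k`. -/
def shift (e : ℕ → ℕ → ℤ) (j k : ℕ) (d : ℤ) : ℕ → ℕ → ℤ :=
  fun i l => if i = j ∧ l = k then e i l + d else e i l

/-- The row sum `r_k = m_{1,k} + … + m_{k,k}`. -/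
def rowSum (e : ℕ → ℕ → ℤ) (k : ℕ) : ℤ := ∑ i ∈ Finset.Icc 1 k, e i k

/-- The coefficient `a_k^j` of `E_{k+1,k}`. -/
def lowerCoeff (e : ℕ → ℕ → ℤ) (k j : ℕ) : ℝ :=
  Real.sqrt (-(((∏ i ∈ Finset.Icc 1 (k + 1), ((e i (k + 1) - e j k - i + j + 1 : ℤ) : ℝ)) *
      ∏ i ∈ Finset.Icc 1 (k - 1), ((e i (k - 1) - e j k - i + j : ℤ) : ℝ)) /
    ∏ i ∈ (Finset.Icc 1 k).erase j,
      (((e i k - e j k - i + j + 1 : ℤ) : ℝ) * ((e i k - e j k - i + j : ℤ) : ℝ))))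

/-- The coefficient `b_k^j` of `E_{k,k+1}`. -/
def raiseCoeff (e : ℕ → ℕ → ℤ) (k j : ℕ) : ℝ :=
  Real.sqrt (-(((∏ i ∈ Finset.Icc 1 (k + 1), ((e i (k + 1) - e j k - i + j : ℤ) : ℝ)) *
      ∏ i ∈ Finset.Icc 1 (k - 1), ((e i (k - 1) - e j k - i + j - 1 : ℤ) : ℝ)) /
    ∏ i ∈ (Finset.Icc 1 k).erase j,
      (((e i k - e j k - i + j : ℤ) : ℝ) * ((e i k - e j k - i + j - 1 : ℤ) : ℝ))))

/-- The linear map with prescribed values on the basis `ξ(𝐦)`. -/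
def onPatterns {n : ℕ} {m : TopRow n} {W : Type*} [AddCommGroup W] [Module ℂ W]
    (f : Pattern m → W) : GTSpace m →ₗ[ℂ] W :=
  Finsupp.linearCombination ℂ f

/-- The operator of `E_{k,k}`: `ξ(𝐦) ↦ (r_k - r_{k-1}) ξ(𝐦)`. -/
def opDiag {n : ℕ} (m : TopRow n) (k : ℕ) : Module.End ℂ (GTSpace m) :=
  onPatterns fun p => ((rowSum p.val k - rowSum p.val (k - 1) : ℤ) : ℂ) • xi m p.val

/-- The operator of `E_{k+1,k}`. -/
def opLower {n : ℕ} (m : TopRow n) (k : ℕ) : Module.End ℂ (GTSpace m) :=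
  onPatterns fun p => ∑ j ∈ Finset.Icc 1 k,
    (lowerCoeff p.val k j : ℂ) • xi m (shift p.val j k (-1))

/-- The operator of `E_{k,k+1}`. -/
def opRaise {n : ℕ} (m : TopRow n) (k : ℕ) : Module.End ℂ (GTSpace m) :=
  onPatterns fun p => ∑ j ∈ Finset.Icc 1 k,
    (raiseCoeff p.val k j : ℂ) • xi m (shift p.val j k 1)

/-- The operator of `E_{k,k+d+1}`, from
`E_{k,k+d+2} = E_{k,k+d+1} E_{k+d+1,k+d+2} - E_{k+d+1,k+d+2} E_{k,k+d+1}`. -/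
def opUp {n : ℕ} (m : TopRow n) (k : ℕ) : ℕ → Module.End ℂ (GTSpace m)
  | 0 => opRaise m k
  | d + 1 => opUp m k d * opRaise m (k + d + 1) - opRaise m (k + d + 1) * opUp m k d

/-- The operator of `E_{k+d+1,k}`, from
`E_{k+d+2,k} = E_{k+d+2,k+d+1} E_{k+d+1,k} - E_{k+d+1,k} E_{k+d+2,k+d+1}`. -/
def opDown {n : ℕ} (m : TopRow n) (k : ℕ) : ℕ → Module.End ℂ (GTSpace m)
  | 0 => opLower m k
  | d + 1 => opLower m (k + d + 1) * opDown m k d - opDown m k d * opLower m (k + d + 1)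

/-- The operator of `E_{k,l}`. -/
def opE {n : ℕ} (m : TopRow n) (k l : ℕ) : Module.End ℂ (GTSpace m) :=
  if k < l then opUp m k (l - k - 1) else if l < k then opDown m l (k - l - 1) else opDiag m k

/-- The Gel'fand–Tseitlin representation `r(m₁, …, mₙ)` of `sl(n, ℂ)`: the operator of
`X = ∑ X_{kl} E_{kl}`. -/
def gtRep {n : ℕ} (m : TopRow n) (X : SL n) : Module.End ℂ (GTSpace m) :=
  ∑ k : Fin n, ∑ l : Fin n, X.val k l • opE m (k + 1) (l + 1)

/-- `φ` is an equivalence between the representation `V` and `r(m₁, …, mₙ)`. -/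
def IsGTEquivalence {n : ℕ} {V : Type*} [AddCommGroup V] [Module ℂ V] [LieRingModule (SL n) V]
    (m : TopRow n) (φ : V ≃ₗ[ℂ] GTSpace m) : Prop :=
  ∀ (X : SL n) (v : V), φ ⁅X, v⁆ = gtRep m X (φ v)

/-- The array `e'_{i,j} = m_{1,n} - e_{j-i+1,j}`. -/
def dualEntries {n : ℕ} (m : TopRow n) (e : ℕ → ℕ → ℤ) : ℕ → ℕ → ℤ :=
  fun i j => if 1 ≤ i ∧ i ≤ j ∧ j ≤ n then m.row 1 - e (j + 1 - i) j else 0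

theorem isPattern_dualEntries {n : ℕ} {m : TopRow n} {e : ℕ → ℕ → ℤ} (he : IsPattern m e) :
    IsPattern m.contra (dualEntries m e) where
  eq_zero i j h := if_neg h
  top i h1 h2 := by
    simp only [dualEntries, TopRow.contra]
    rw [if_pos ⟨h1, h2, le_rfl⟩, if_pos ⟨h1, h2⟩, he.top _ (by omega) (by omega)]
  le_left i j h1 h2 h3 := by
    simp only [dualEntries]
    rw [if_pos ⟨h1, h2, by omega⟩, if_pos ⟨h1, by omega, h3⟩]
    have h := he.right_le (j + 1 - i) j (by omega) (by omega) h3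
    rw [show j + 1 - i + 1 = j + 1 + 1 - i by omega] at h
    omega
  right_le i j h1 h2 h3 := by
    simp only [dualEntries]
    rw [if_pos ⟨by omega, by omega, by omega⟩, if_pos ⟨h1, by omega, by omega⟩]
    have h := he.le_left (j + 1 - i) j (by omega) (by omega) h3
    rw [show j + 1 + 1 - (i + 1) = j + 1 - i by omega]
    omega

/-- The pattern `𝐦'`, with top row `m' = m.contra`. -/
def dualPattern {n : ℕ} {m m' : TopRow n} (h : m.contra = m') (p : Pattern m) : Pattern m' :=
  ⟨dualEntries m p.val, h ▸ isPattern_dualEntries p.property⟩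

/-- The sum of all entries of a pattern. -/
def entrySum (n : ℕ) (e : ℕ → ℕ → ℤ) : ℤ := ∑ k ∈ Finset.Icc 1 n, rowSum e k

/-- The intertwiner `J ξ(𝐦) = (-1)^{∑ m_{i,j}} ξ(𝐦')` from the space of `r(m)` to that
of `r(m')`, where `m' = m.contra`. -/
def opJ {n : ℕ} {m m' : TopRow n} (h : m.contra = m') : GTSpace m →ₗ[ℂ] GTSpace m' :=
  onPatterns fun p => ((-1 : ℂ) ^ entrySum n p.val) • Finsupp.single (dualPattern h p) 1

/-- The sign `(-1)^{m₁ n(n+1)/2}`. -/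
def signJ {n : ℕ} (m : TopRow n) : ℂ := (-1 : ℂ) ^ (m.row 1 * ((n * (n + 1) / 2 : ℕ) : ℤ))

end SlGrading

end

noncomputable section

namespace SlGrading

/-! ### Representations as linear maps -/

section Reps

variable {L : Type*} [LieRing L] [LieAlgebra ℂ L]
variable {U V W : Type*} [AddCommGroup U] [Module ℂ U] [AddCommGroup V] [Module ℂ V]
  [AddCommGroup W] [Module ℂ W]

/-! The criterion rests on replacing gradings by twists. For an involution `g`, a compatible grading
of an irreducible `V` is the same as an equivalence of `V` with its twist by `g`
(`compatible_iff_intertwined`): a grading gives the reflection that is `1` on `V₀` and `-1` on `V₁`,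
and by Schur's lemma any intertwiner can be rescaled to an involution, whose eigenspaces form a
grading. It remains to see that the twist by an outer `g` is the contragredient.

For `X ↦ -Xᵀ` this is a comparison of lowest weights (`intertwined_outI_dual`), based on the fact
that a lowest weight determines an irreducible representation (`intertwined_of_isLowest`). A general
outer automorphism is `X ↦ -Xᵀ` followed by a conjugation (`automorphism_classification`), and
conjugations do not change the class of a representation, since they are implemented by products of
exponentials of nilpotent operators (`exists_conj`). The classification uses that traceless matrices
of rank at most one are characterised by brackets alone (`IsExtremal`), so automorphisms preserve
them.

For `J`, reversing each row of a pattern exchanges the coefficients `a` and `b`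
(`raiseCoeff_dualEntries`), and the sign `(-1)^{∑ m_{i,j}}` supplies the minus sign of `-Xᵀ`.
Finally `r(m)` and `r(m')` are equivalent only if `m = m'`, because the largest eigenvalues of the
coweights determine the top row (`topRow_eq_of_equiv`). Nowhere is it needed that `gtRep` respects
brackets.

Representations are treated as linear maps into endomorphisms, so twists, duals and sums require no
new module structures. -/

/-- A linear map to endomorphisms that turns brackets into commutators. -/
def IsLieRep (ρ : L →ₗ[ℂ] Module.End ℂ V) : Prop :=
  ∀ x y, ρ ⁅x, y⁆ = ρ x * ρ y - ρ y * ρ x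

/-- The space is nonzero and has no proper nonzero invariant subspace. -/
def IsIrred (ρ : L →ₗ[ℂ] Module.End ℂ V) : Prop :=
  Nontrivial V ∧ ∀ p : Submodule ℂ V, (∀ x, ∀ v ∈ p, ρ x v ∈ p) → p = ⊥ ∨ p = ⊤

/-- Equivalence of representations. -/
def Intertwined (ρ : L →ₗ[ℂ] Module.End ℂ V) (σ : L →ₗ[ℂ] Module.End ℂ W) : Prop :=
  ∃ e : V ≃ₗ[ℂ] W, ∀ x v, e (ρ x v) = σ x (e v)

theorem IsLieRep.apply {ρ : L →ₗ[ℂ] Module.End ℂ V} (h : IsLieRep ρ) (x y : L) (v : V) :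
    ρ x (ρ y v) = ρ ⁅x, y⁆ v + ρ y (ρ x v) := by
  rw [h x y]; simp

theorem Intertwined.symm {ρ : L →ₗ[ℂ] Module.End ℂ V} {σ : L →ₗ[ℂ] Module.End ℂ W}
    (h : Intertwined ρ σ) : Intertwined σ ρ := by
  obtain ⟨e, he⟩ := h
  exact ⟨e.symm, fun x v => e.injective (by simp [he])⟩

theorem Intertwined.trans {ρ : L →ₗ[ℂ] Module.End ℂ U} {σ : L →ₗ[ℂ] Module.End ℂ V}
    {τ : L →ₗ[ℂ] Module.End ℂ W} (h : Intertwined ρ σ) (h' : Intertwined σ τ) :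
    Intertwined ρ τ := by
  obtain ⟨e, he⟩ := h
  obtain ⟨f, hf⟩ := h'
  exact ⟨e.trans f, fun x v => by simp [he, hf]⟩

theorem Intertwined.comp {ρ : L →ₗ[ℂ] Module.End ℂ V} {σ : L →ₗ[ℂ] Module.End ℂ W}
    (h : Intertwined ρ σ) (g : L →ₗ[ℂ] L) : Intertwined (ρ ∘ₗ g) (σ ∘ₗ g) := by
  obtain ⟨e, he⟩ := h
  exact ⟨e, fun x v => he (g x) v⟩

theorem IsLieRep.comp {ρ : L →ₗ[ℂ] Module.End ℂ V} (h : IsLieRep ρ) (g : L ≃ₗ⁅ℂ⁆ L) :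
    IsLieRep (ρ ∘ₗ (g.toLinearEquiv : L →ₗ[ℂ] L)) := by
  intro x y
  have : g ⁅x, y⁆ = ⁅g x, g y⁆ := LieEquiv.map_lie g x y
  change ρ (g ⁅x, y⁆) = ρ (g x) * ρ (g y) - ρ (g y) * ρ (g x)
  rw [this, h]

theorem IsIrred.comp {ρ : L →ₗ[ℂ] Module.End ℂ V} (h : IsIrred ρ) (g : L ≃ₗ⁅ℂ⁆ L) :
    IsIrred (ρ ∘ₗ (g.toLinearEquiv : L →ₗ[ℂ] L)) := by
  refine ⟨h.1, fun p hp => h.2 p fun x v hv => ?_⟩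
  have := hp (g.symm x) v hv
  simpa using this

/-- The operators of the contragredient representation. -/
def dualRep (ρ : L →ₗ[ℂ] Module.End ℂ V) : L →ₗ[ℂ] Module.End ℂ (Module.Dual ℂ V) :=
  -((Module.Dual.transpose (R := ℂ) (M := V) (M' := V)) ∘ₗ ρ)

@[simp]
theorem dualRep_apply (ρ : L →ₗ[ℂ] Module.End ℂ V) (x : L) (f : Module.Dual ℂ V) (v : V) :
    dualRep ρ x f v = -f (ρ x v) := by
  simp [dualRep, Module.Dual.transpose_apply]

theorem IsLieRep.dual {ρ : L →ₗ[ℂ] Module.End ℂ V} (h : IsLieRep ρ) : IsLieRep (dualRep ρ) := by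
  intro x y
  ext f v
  simp [h x y]

/-- The coannihilator of an invariant subspace of the dual is invariant in `V`, and in finite
dimension the subspace is recovered as the annihilator of its coannihilator. -/
theorem IsIrred.dual [FiniteDimensional ℂ V] {ρ : L →ₗ[ℂ] Module.End ℂ V} (h : IsIrred ρ) :
    IsIrred (dualRep ρ) := by
  have := h.1
  refine ⟨inferInstance, fun p hp => ?_⟩
  have := h.2 p.dualCoannihilator fun x v hv => by
    rw [Submodule.mem_dualCoannihilator] at hv ⊢
    intro f hf
    have := hv _ (hp x f hf)
    simpa using this
  rw [← Subspace.dualCoannihilator_dualAnnihilator_eq (W := p)]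
  rcases this with h | h <;> rw [h] <;> simp

/-- Schur's lemma. -/
theorem IsIrred.exists_eq_smul [FiniteDimensional ℂ V] {ρ : L →ₗ[ℂ] Module.End ℂ V}
    (h : IsIrred ρ) (T : Module.End ℂ V) (hT : ∀ x v, T (ρ x v) = ρ x (T v)) :
    ∃ c : ℂ, ∀ v, T v = c • v := by
  have := h.1
  obtain ⟨c, hc⟩ := Module.End.exists_eigenvalue T
  refine ⟨c, ?_⟩
  rcases h.2 (T.eigenspace c) fun x v hv => by
    rw [Module.End.mem_eigenspace_iff] at hv ⊢
    rw [hT, hv, map_smul] with h | h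
  · exact absurd h hc
  · exact fun v => Module.End.mem_eigenspace_iff.mp (h ▸ Submodule.mem_top)

theorem mem_z2Grading_zero {g : L ≃ₗ⁅ℂ⁆ L} {x : L} : x ∈ z2Grading g 0 ↔ g x = x := by
  simp [z2Grading]

theorem mem_z2Grading_one {g : L ≃ₗ⁅ℂ⁆ L} {x : L} : x ∈ z2Grading g 1 ↔ g x = -x := by
  simp [z2Grading]

end Reps

/-! ### Compatible gradings as equivalences with a twist. -/

section Modules

variable {L : Type*} [LieRing L] [LieAlgebra ℂ L]
variable (V : Type*) [AddCommGroup V] [Module ℂ V] [LieRingModule L V] [LieModule ℂ L V]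

/-- The operators by which a Lie algebra acts on a Lie module. -/
def actionMap : L →ₗ[ℂ] Module.End ℂ V := (LieModule.toEnd ℂ L V : L →ₗ[ℂ] Module.End ℂ V)

@[simp]
theorem actionMap_apply (x : L) (v : V) : actionMap V x v = ⁅x, v⁆ := rfl

theorem isLieRep_actionMap : IsLieRep (actionMap (L := L) V) := by
  intro x y
  ext v
  simp

theorem isIrred_actionMap [LieModule.IsIrreducible ℂ L V] : IsIrred (actionMap (L := L) V) := by
  refine ⟨LieModule.nontrivial_of_isIrreducible ℂ L V, fun p hp => ?_⟩
  let N : LieSubmodule ℂ L V := { p with lie_mem := fun {x v} hv => hp x v hv }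
  have hN : N.toSubmodule = p := rfl
  rcases eq_bot_or_eq_top N with h | h
  · left; rw [← hN, h]; simp
  · right; rw [← hN, h]; simp

theorem selfContragredient_iff :
    SelfContragredient L V ↔ Intertwined (actionMap (L := L) V) (dualRep (actionMap V)) := by
  constructor
  · rintro ⟨e⟩
    refine ⟨e.toLinearEquiv, fun x v => ?_⟩
    ext w
    have := e.toLieModuleHom.map_lie x v
    have h2 := LinearMap.congr_fun this w
    exact h2
  · rintro ⟨e, he⟩
    refine ⟨{ e with map_lie' := fun {x v} => ?_ }⟩
    ext w
    have := LinearMap.congr_fun (he x v) w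
    simpa using this

/-- A `ℤ₂`-grading given by an involution `g` is compatible with an irreducible representation
iff the representation is equivalent to its twist by `g`. -/
theorem compatible_iff_intertwined [FiniteDimensional ℂ V] [LieModule.IsIrreducible ℂ L V]
    (g : L ≃ₗ⁅ℂ⁆ L) (hg : ∀ x, g (g x) = x) :
    Compatible (z2Grading g) V ↔
      Intertwined (actionMap V ∘ₗ (g.toLinearEquiv : L →ₗ[ℂ] L)) (actionMap V) := by
  have hne : (0 : ZMod 2) ≠ 1 := by decide
  have huniv : (Set.univ : Set (ZMod 2)) = {0, 1} := by
    ext i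
    have : i = 0 ∨ i = 1 := by revert i; decide
    simpa using this
  constructor
  · rintro ⟨W, hW, hact⟩
    have hc : IsCompl (W 0) (W 1) := (DirectSum.isInternal_submodule_iff_isCompl W hne huniv).mp hW
    have hex : ∀ v : V, ∃ a ∈ W 0, ∃ b ∈ W 1, a + b = v := fun v =>
      Submodule.mem_sup.mp (hc.sup_eq_top ▸ Submodule.mem_top)
    let P := (W 0).projectionOnto (W 1) hc
    -- `R` is `1` on `W 0` and `-1` on `W 1`; even elements commute with it and odd elements
    -- anticommute, which is the twist by `g`.
    let R : Module.End ℂ V := (2 : ℂ) • ((W 0).subtype ∘ₗ P) - 1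
    have hR0 : ∀ a ∈ W 0, R a = a := by
      intro a ha
      have : P a = ⟨a, ha⟩ := Submodule.projectionOnto_apply_left hc ⟨a, ha⟩
      simp [R, this, two_smul]
    have hR1 : ∀ b ∈ W 1, R b = -b := by
      intro b hb
      have : P b = 0 := (Submodule.projectionOnto_apply_eq_zero_iff hc).mpr hb
      simp [R, this]
    have hRR : R * R = 1 := by
      ext v
      obtain ⟨a, ha, b, hb, rfl⟩ := hex v
      simp [hR0 a ha, hR1 b hb]
    have hx0 : ∀ x, g x = x → ∀ v, R ⁅g x, v⁆ = ⁅x, R v⁆ := by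
      intro x hx v
      obtain ⟨a, ha, b, hb, rfl⟩ := hex v
      have h1 := hact 0 0 x (mem_z2Grading_zero.mpr hx) a ha
      have h2 := hact 0 1 x (mem_z2Grading_zero.mpr hx) b hb
      rw [add_zero] at h1
      rw [zero_add] at h2
      rw [hx, lie_add, map_add, map_add, hR0 _ h1, hR1 _ h2, hR0 a ha, hR1 b hb, lie_add, lie_neg]
    have hx1 : ∀ x, g x = -x → ∀ v, R ⁅g x, v⁆ = ⁅x, R v⁆ := by
      intro x hx v
      obtain ⟨a, ha, b, hb, rfl⟩ := hex v
      have h1 := hact 1 0 x (mem_z2Grading_one.mpr hx) a ha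
      have h2 := hact 1 1 x (mem_z2Grading_one.mpr hx) b hb
      rw [add_zero] at h1
      rw [show (1 + 1 : ZMod 2) = 0 from by decide] at h2
      rw [hx, lie_add, map_add, map_add, neg_lie, neg_lie, map_neg, map_neg, hR0 _ h2, hR1 _ h1,
        hR0 a ha, hR1 b hb, lie_add, lie_neg, neg_neg]
    refine ⟨LinearEquiv.ofLinearMap R R hRR hRR, fun x v => ?_⟩
    have hsplit : x = (1 / 2 : ℂ) • (x + g x) + (1 / 2 : ℂ) • (x - g x) := by
      rw [← smul_add, add_add_sub_cancel, ← two_smul ℂ x, smul_smul]; norm_num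
    have e0 : g ((1 / 2 : ℂ) • (x + g x)) = (1 / 2 : ℂ) • (x + g x) := by
      rw [map_smul, map_add, hg, add_comm]
    have e1 : g ((1 / 2 : ℂ) • (x - g x)) = -((1 / 2 : ℂ) • (x - g x)) := by
      rw [map_smul, map_sub, hg, ← smul_neg, neg_sub]
    change R ⁅g x, v⁆ = ⁅x, R v⁆
    rw [hsplit, map_add, add_lie, map_add, hx0 _ e0, hx1 _ e1, add_lie]
  · rintro ⟨e, he⟩
    have he' : ∀ x v, e ⁅g x, v⁆ = ⁅x, e v⁆ := he
    have he'' : ∀ x v, e ⁅x, v⁆ = ⁅g x, e v⁆ := fun x v => by rw [← he', hg]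
    have hirr := isIrred_actionMap (L := L) V
    have := hirr.1
    -- Since `g` is an involution, `e ∘ e` commutes with the action, so it is a scalar `c`. Dividing
    -- `e` by a square root of `c` gives an involution `R`, whose eigenspaces are the required
    -- grading.
    obtain ⟨c, hc⟩ := hirr.exists_eq_smul ((e : V →ₗ[ℂ] V) ∘ₗ (e : V →ₗ[ℂ] V)) fun x v => by
      simp [he', he'']
    obtain ⟨d, hd⟩ := IsAlgClosed.exists_pow_nat_eq c (n := 2) (by norm_num)
    have hc0 : c ≠ 0 := by
      rintro rfl
      obtain ⟨v, hv⟩ := exists_ne (0 : V)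
      have := hc v
      simp [hv] at this
    have hd0 : d ≠ 0 := by rintro rfl; simp at hd; exact hc0 hd.symm
    let R : Module.End ℂ V := d⁻¹ • (e : V →ₗ[ℂ] V)
    have hRR : ∀ v, R (R v) = v := by
      intro v
      have := hc v
      simp only [LinearMap.comp_apply, LinearEquiv.coe_coe] at this
      simp only [R, LinearMap.smul_apply, LinearEquiv.coe_coe, map_smul, this, smul_smul, ← hd]
      rw [show d⁻¹ * (d⁻¹ * d ^ 2) = 1 by field_simp, one_smul]
    have hRx : ∀ x v, R ⁅x, v⁆ = ⁅g x, R v⁆ := by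
      intro x v
      simp [R, he'']
    let W : ZMod 2 → Submodule ℂ V := fun i => R.eigenspace (if i = 0 then 1 else -1)
    have m0 : ∀ v, v ∈ W 0 ↔ R v = v := fun v => by simp [W]
    have m1 : ∀ v, v ∈ W 1 ↔ R v = -v := fun v => by simp [W]
    refine ⟨W, ?_, ?_⟩
    · rw [DirectSum.isInternal_submodule_iff_isCompl W hne huniv]
      constructor
      · rw [Submodule.disjoint_def]
        intro v h0 h1
        rw [m0] at h0
        rw [m1, h0] at h1
        rwa [eq_neg_iff_add_eq_zero, ← two_smul ℂ v, smul_eq_zero_iff_right two_ne_zero] at h1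
      · rw [codisjoint_iff, eq_top_iff]
        intro v _
        refine Submodule.mem_sup.mpr ⟨(1 / 2 : ℂ) • (v + R v), (m0 _).mpr ?_,
          (1 / 2 : ℂ) • (v - R v), (m1 _).mpr ?_, ?_⟩
        · rw [map_smul, map_add, hRR, add_comm]
        · rw [map_smul, map_sub, hRR, ← smul_neg, neg_sub]
        · rw [← smul_add, add_add_sub_cancel, ← two_smul ℂ v, smul_smul]; norm_num
    · intro i j x hx v hv
      fin_cases i <;> fin_cases j
      · change x ∈ z2Grading g 0 at hx
        change v ∈ W 0 at hv
        change _ ∈ W (0 + 0)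
        rw [mem_z2Grading_zero] at hx
        rw [m0] at hv
        rw [add_zero, m0, hRx, hx, hv]
      · change x ∈ z2Grading g 0 at hx
        change v ∈ W 1 at hv
        change _ ∈ W (0 + 1)
        rw [mem_z2Grading_zero] at hx
        rw [m1] at hv
        rw [zero_add, m1, hRx, hx, hv, lie_neg]
      · change x ∈ z2Grading g 1 at hx
        change v ∈ W 0 at hv
        change _ ∈ W (1 + 0)
        rw [mem_z2Grading_one] at hx
        rw [m0] at hv
        rw [add_zero, m1, hRx, hx, hv, neg_lie]
      · change x ∈ z2Grading g 1 at hx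
        change v ∈ W 1 at hv
        change _ ∈ W (1 + 1)
        rw [mem_z2Grading_one] at hx
        rw [m1] at hv
        rw [show (1 + 1 : ZMod 2) = 0 from by decide, m0, hRx, hx, hv, neg_lie, lie_neg, neg_neg]

end Modules

/-! ### Elementary elements of `sl(n, ℂ)` -/

section Elementary

variable {n : ℕ}

/-- The matrix unit `E_{ij}`, `i ≠ j`, as an element of `sl(n, ℂ)`. -/
def slE (i j : Fin n) (h : i ≠ j) : SL n := LieAlgebra.SpecialLinear.single i j h 1

@[simp]
theorem slE_val (i j : Fin n) (h : i ≠ j) : (slE i j h).val = Matrix.single i j (1 : ℂ) := rfl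

/-- The inclusion of `sl(n, ℂ)` in the matrices. -/
def slVal : SL n →ₗ[ℂ] Matrix (Fin n) (Fin n) ℂ where
  toFun X := X.val
  map_add' _ _ := rfl
  map_smul' _ _ := rfl

theorem sl_bracket_val (X Y : SL n) : (⁅X, Y⁆ : SL n).val = X.val * Y.val - Y.val * X.val := rfl

theorem outI_val (X : SL n) : (outI n X).val = -X.val.transpose := rfl

theorem outI_outI (X : SL n) : outI n (outI n X) = X :=
  Subtype.ext (by simp [outI_val])

theorem outI_slE (i j : Fin n) (h : i ≠ j) : outI n (slE i j h) = -slE j i h.symm :=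
  Subtype.ext (by
    change -(Matrix.single i j (1 : ℂ)).transpose = -Matrix.single j i (1 : ℂ)
    rw [Matrix.transpose_single])

theorem outI_of_isDiag {D : SL n} (hD : D.val.IsDiag) : outI n D = -D :=
  Subtype.ext (by
    change -D.val.transpose = -D.val
    rw [hD.isSymm.eq])

theorem lie_slE_of_isDiag {D : SL n} (hD : D.val.IsDiag) (i j : Fin n) (h : i ≠ j) :
    ⁅D, slE i j h⁆ = (D.val i i - D.val j j) • slE i j h := by
  apply Subtype.ext
  change D.val * Matrix.single i j 1 - Matrix.single i j 1 * D.val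
    = (D.val i i - D.val j j) • Matrix.single i j (1 : ℂ)
  ext a b
  by_cases hai : a = i <;> by_cases hbj : b = j
  · subst hai hbj; simp
  · subst hai
    simp [hbj, hD (Ne.symm hbj), Ne.symm hbj]
  · subst hbj
    simp [hai, hD hai, Ne.symm hai]
  · simp [hai, hbj, Ne.symm hai, Ne.symm hbj]

theorem lie_eq_zero_of_isDiag {D D' : SL n} (hD : D.val.IsDiag) (hD' : D'.val.IsDiag) :
    ⁅D, D'⁆ = 0 := by
  apply Subtype.ext
  change D.val * D'.val - D'.val * D.val = 0
  rw [← hD.diagonal_diag, ← hD'.diagonal_diag, Matrix.diagonal_mul_diagonal,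
    Matrix.diagonal_mul_diagonal, sub_eq_zero]
  congr 1
  ext i
  exact mul_comm _ _

/-- A property of elements of `sl(n, ℂ)` that is stable under sums and holds for diagonal
elements and multiples of matrix units holds for all elements. -/
theorem sl_induction {P : SL n → Prop} (hadd : ∀ X Y, P X → P Y → P (X + Y))
    (hsingle : ∀ i j h (c : ℂ), P (c • slE i j h)) (hdiag : ∀ D : SL n, D.val.IsDiag → P D)
    (X : SL n) : P X := by
  let O : SL n := ∑ p : Fin n × Fin n, if h : p.1 ≠ p.2 then X.val p.1 p.2 • slE p.1 p.2 h else 0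
  have hO : P O := by
    refine Finset.sum_induction _ P hadd (hdiag 0 ?_) fun p _ => ?_
    · change (0 : Matrix (Fin n) (Fin n) ℂ).IsDiag
      exact Matrix.isDiag_zero
    · split_ifs with h
      · exact hsingle _ _ h _
      · exact hdiag 0 Matrix.isDiag_zero
  have hOval : O.val = ∑ p : Fin n × Fin n,
      if p.1 ≠ p.2 then X.val p.1 p.2 • Matrix.single p.1 p.2 (1 : ℂ) else 0 := by
    change slVal O = _
    rw [map_sum]
    refine Finset.sum_congr rfl fun p _ => ?_
    split_ifs <;> rfl
  have hD : (X - O).val.IsDiag := by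
    intro i j hij
    change X.val i j - O.val i j = 0
    rw [hOval, Matrix.sum_apply, Finset.sum_eq_single (i, j)]
    · simp [hij]
    · rintro ⟨a, b⟩ _ hab
      by_cases h : a = b
      · simp [h]
      · have : ¬ (a = i ∧ b = j) := by rintro ⟨rfl, rfl⟩; exact hab rfl
        simp [h, this]
    · simp
  rw [← sub_add_cancel X O]
  exact hadd _ _ (hdiag _ hD) hO

/-- A diagonal element with `[H, E_{ij}] = (j - i) E_{ij}`. -/
def gradingElt (n : ℕ) : SL n :=
  ⟨Matrix.diagonal fun i : Fin n => (∑ j : Fin n, (j : ℂ)) / n - i, by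
    change Matrix.trace (Matrix.diagonal fun i : Fin n => (∑ j : Fin n, (j : ℂ)) / n - i) = 0
    rw [Matrix.trace_diagonal, Finset.sum_sub_distrib]
    rcases Nat.eq_zero_or_pos n with rfl | h
    · simp
    · have : (n : ℂ) ≠ 0 := by exact_mod_cast h.ne'
      simp [mul_div_cancel₀ _ this]⟩

theorem gradingElt_isDiag : (gradingElt n).val.IsDiag := Matrix.isDiag_diagonal _

theorem lie_gradingElt (i j : Fin n) (h : i ≠ j) :
    ⁅gradingElt n, slE i j h⁆ = ((j : ℂ) - i) • slE i j h := by
  rw [lie_slE_of_isDiag gradingElt_isDiag]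
  simp [gradingElt]

end Elementary

/-! ### Lowest vectors -/

section Lowest

variable {n : ℕ} {V W : Type*} [AddCommGroup V] [Module ℂ V] [AddCommGroup W] [Module ℂ W]

/-- `w` is a common eigenvector of the diagonal elements with eigenvalues `χ`, annihilated by the
strictly lower triangular elements. -/
structure IsLowest (ρ : SL n →ₗ[ℂ] Module.End ℂ V) (w : V) (χ : SL n → ℂ) : Prop where
  diag : ∀ D : SL n, D.val.IsDiag → ρ D w = χ D • w
  lower : ∀ i j (h : j < i), ρ (slE i j h.ne') w = 0

/-- On a minimal nonzero stable subspace each operator of `S` has an eigenvector, and by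
commutativity its eigenspace there is again stable, hence everything. Every nonzero vector of the
minimal subspace is therefore a common eigenvector. -/
theorem exists_common_eigenvector [FiniteDimensional ℂ V] {S : Set (Module.End ℂ V)}
    (hS : ∀ s ∈ S, ∀ t ∈ S, ∀ v, s (t v) = t (s v)) (p₀ : Submodule ℂ V) (h0 : p₀ ≠ ⊥)
    (hp₀ : ∀ s ∈ S, ∀ v ∈ p₀, s v ∈ p₀) :
    ∃ w ∈ p₀, w ≠ 0 ∧ ∀ s ∈ S, ∃ c : ℂ, s w = c • w := by
  obtain ⟨p, ⟨hp, hle, hinv⟩, hmin⟩ := wellFounded_lt.has_min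
    {p : Submodule ℂ V | p ≠ ⊥ ∧ p ≤ p₀ ∧ ∀ s ∈ S, ∀ v ∈ p, s v ∈ p} ⟨p₀, h0, le_rfl, hp₀⟩
  obtain ⟨w, hw, hw0⟩ := p.ne_bot_iff.mp hp
  refine ⟨w, hle hw, hw0, fun s hs => ?_⟩
  have : Nontrivial p := Submodule.nontrivial_iff_ne_bot.mpr hp
  obtain ⟨c, hc⟩ := Module.End.exists_eigenvalue (LinearMap.restrict s (hinv s hs))
  obtain ⟨u, hu, hu0⟩ := hc.exists_hasEigenvector
  have hu' : s u = c • (u : V) := congrArg Subtype.val (Module.End.mem_eigenspace_iff.mp hu)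
  refine ⟨c, ?_⟩
  have hq : p ⊓ s.eigenspace c = p := by
    by_contra hne
    refine hmin (p ⊓ s.eigenspace c) ⟨?_, inf_le_left.trans hle, ?_⟩ (lt_of_le_of_ne inf_le_left hne)
    · rw [Submodule.ne_bot_iff]
      exact ⟨u, ⟨u.2, Module.End.mem_eigenspace_iff.mpr hu'⟩, by simpa using hu0⟩
    · rintro t ht v ⟨hv1, hv2⟩
      refine ⟨hinv t ht v hv1, Module.End.mem_eigenspace_iff.mpr ?_⟩
      rw [hS s hs t ht, Module.End.mem_eigenspace_iff.mp hv2, map_smul]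
  exact Module.End.mem_eigenspace_iff.mp (hq.ge hw).2

theorem slE_mem_eigenspace {ρ : SL n →ₗ[ℂ] Module.End ℂ V} (hρ : IsLieRep ρ) {μ : ℂ} {v : V}
    (hv : v ∈ (ρ (gradingElt n)).eigenspace μ) (i j : Fin n) (h : i ≠ j) :
    ρ (slE i j h) v ∈ (ρ (gradingElt n)).eigenspace (μ + ((j : ℂ) - i)) := by
  rw [Module.End.mem_eigenspace_iff] at hv ⊢
  rw [hρ.apply, hv, lie_gradingElt, map_smul, map_smul, LinearMap.smul_apply, ← add_smul, add_comm]

/-- In the eigenspace of `gradingElt` whose eigenvalue has least real part, strictly lower units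
must act by zero, since they would decrease the eigenvalue. The diagonal elements commute and
preserve this eigenspace, so they have a common eigenvector in it. -/
theorem exists_isLowest [FiniteDimensional ℂ V] [Nontrivial V]
    {ρ : SL n →ₗ[ℂ] Module.End ℂ V} (hρ : IsLieRep ρ) :
    ∃ w χ, w ≠ 0 ∧ IsLowest ρ w χ := by
  obtain ⟨c, hc⟩ := Module.End.exists_eigenvalue (ρ (gradingElt n))
  have hfin : Set.Finite {c | (ρ (gradingElt n)).HasEigenvalue c} :=
    Module.End.finite_hasEigenvalue (ρ (gradingElt n))
  obtain ⟨μ, hμ, hmin⟩ := Set.exists_min_image _ Complex.re hfin ⟨c, hc⟩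
  obtain ⟨w, hw, hw0, hc⟩ := exists_common_eigenvector
    (S := {s | ∃ D : SL n, D.val.IsDiag ∧ ρ D = s}) (by
      rintro _ ⟨D, hD, rfl⟩ _ ⟨D', hD', rfl⟩ v
      rw [hρ.apply, lie_eq_zero_of_isDiag hD hD']; simp) ((ρ (gradingElt n)).eigenspace μ) hμ (by
      rintro _ ⟨D, hD, rfl⟩ v hv
      rw [Module.End.mem_eigenspace_iff] at hv ⊢
      rw [hρ.apply, lie_eq_zero_of_isDiag gradingElt_isDiag hD, hv]; simp)
  have hc' : ∀ D : SL n, ∃ c : ℂ, D.val.IsDiag → ρ D w = c • w := by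
    intro D
    by_cases hD : D.val.IsDiag
    · obtain ⟨c, hc⟩ := hc _ ⟨D, hD, rfl⟩
      exact ⟨c, fun _ => hc⟩
    · exact ⟨0, fun h => absurd h hD⟩
  choose χ hχ using hc'
  refine ⟨w, χ, hw0, hχ, fun i j h => ?_⟩
  by_contra hne
  have := hmin _ (Module.End.hasEigenvalue_of_hasEigenvector
    ⟨slE_mem_eigenspace hρ hw i j h.ne', hne⟩)
  have hlt : ((j : ℕ) : ℝ) < ((i : ℕ) : ℝ) := by exact_mod_cast h
  simp only [Complex.add_re, Complex.sub_re, Complex.natCast_re] at this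
  linarith

/-- The smallest subspace that contains `w` and is stable under the strictly upper triangular
elements. -/
def upperSpan (ρ : SL n →ₗ[ℂ] Module.End ℂ V) (w : V) : Submodule ℂ V :=
  sInf {p | w ∈ p ∧ ∀ i j (h : i < j), ∀ v ∈ p, ρ (slE i j h.ne) v ∈ p}

theorem mem_upperSpan (ρ : SL n →ₗ[ℂ] Module.End ℂ V) (w : V) : w ∈ upperSpan ρ w :=
  Submodule.mem_sInf.mpr fun _ hp => hp.1

theorem slE_mem_upperSpan {ρ : SL n →ₗ[ℂ] Module.End ℂ V} {w v : V} (hv : v ∈ upperSpan ρ w)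
    (i j : Fin n) (h : i < j) : ρ (slE i j h.ne) v ∈ upperSpan ρ w :=
  Submodule.mem_sInf.mpr fun p hp => hp.2 i j h v (Submodule.mem_sInf.mp hv p hp)

theorem upperSpan_le {ρ : SL n →ₗ[ℂ] Module.End ℂ V} {w : V} {p : Submodule ℂ V} (hw : w ∈ p)
    (hp : ∀ i j (h : i < j), ∀ v ∈ p, ρ (slE i j h.ne) v ∈ p) : upperSpan ρ w ≤ p :=
  sInf_le ⟨hw, hp⟩

theorem upperSpan_invariant {ρ : SL n →ₗ[ℂ] Module.End ℂ V} (hρ : IsLieRep ρ) {w : V}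
    {χ : SL n → ℂ} (hw : IsLowest ρ w χ) (X : SL n) {v : V} (hv : v ∈ upperSpan ρ w) :
    ρ X v ∈ upperSpan ρ w := by
  -- All `X` are treated at once because moving `X` past an upper unit `E` produces the arbitrary
  -- element `[X, E]`. With this choice `p` contains `w` and is stable under upper units, hence is
  -- the whole span.
  let p : Submodule ℂ V := upperSpan ρ w ⊓ ⨅ X : SL n, (upperSpan ρ w).comap (ρ X)
  have hp : ∀ v, v ∈ p ↔ v ∈ upperSpan ρ w ∧ ∀ X, ρ X v ∈ upperSpan ρ w := by
    intro v; simp [p]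
  suffices upperSpan ρ w ≤ p from ((hp v).mp (this hv)).2 X
  refine upperSpan_le ((hp w).mpr ⟨mem_upperSpan ρ w, fun X => ?_⟩) fun i j h v hv => ?_
  · induction X using sl_induction with
    | hadd X Y hX hY => rw [map_add]; exact add_mem hX hY
    | hsingle i j h c =>
      rw [map_smul, LinearMap.smul_apply]
      refine Submodule.smul_mem _ _ ?_
      rcases lt_or_gt_of_ne h with h' | h'
      · exact slE_mem_upperSpan (mem_upperSpan ρ w) i j h'
      · rw [hw.lower i j h']; exact zero_mem _
    | hdiag D hD => rw [hw.diag D hD]; exact Submodule.smul_mem _ _ (mem_upperSpan ρ w)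
  · rw [hp] at hv ⊢
    refine ⟨slE_mem_upperSpan hv.1 i j h, fun X => ?_⟩
    rw [hρ.apply]
    exact add_mem (hv.2 _) (slE_mem_upperSpan (hv.2 X) i j h)

/-- Upper units raise the eigenvalue `μ` of `w` by positive integers, so the span lies in `ℂ w` plus
the eigenspaces for `μ + 1, μ + 2, …`. Independence of eigenspaces leaves only `ℂ w` at `μ`. -/
theorem upperSpan_inf_eigenspace {ρ : SL n →ₗ[ℂ] Module.End ℂ V} (hρ : IsLieRep ρ) {w : V}
    {χ : SL n → ℂ} (hw : IsLowest ρ w χ) {v : V} (hv : v ∈ upperSpan ρ w)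
    (hv' : v ∈ (ρ (gradingElt n)).eigenspace (χ (gradingElt n))) : ∃ a : ℂ, a • w = v := by
  set T := ρ (gradingElt n)
  set μ := χ (gradingElt n)
  have hwμ : w ∈ T.eigenspace μ :=
    Module.End.mem_eigenspace_iff.mpr (hw.diag _ gradingElt_isDiag)
  let Q : Submodule ℂ V := ⨆ k : ℕ, T.eigenspace (μ + (k + 1))
  have hQ : ∀ i j (h : i < j), ∀ v ∈ Q, ρ (slE i j h.ne) v ∈ Q := by
    intro i j h v hv
    have : Q ≤ Q.comap (ρ (slE i j h.ne)) := by
      refine iSup_le fun k u hu => ?_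
      have := slE_mem_eigenspace hρ hu i j h.ne
      have hk : μ + ((k : ℂ) + 1) + ((j : ℂ) - i) = μ + (((k + (j - i) : ℕ) : ℂ) + 1) := by
        rw [Nat.cast_add, Nat.cast_sub (by exact_mod_cast h.le)]; ring
      rw [hk] at this
      exact (le_iSup (fun k : ℕ => T.eigenspace (μ + (k + 1))) _) this
    exact this hv
  have hle : upperSpan ρ w ≤ Submodule.span ℂ {w} ⊔ Q := by
    refine upperSpan_le (Submodule.mem_sup_left (Submodule.mem_span_singleton_self w))
      fun i j h v hv => ?_
    obtain ⟨y, hy, z, hz, rfl⟩ := Submodule.mem_sup.mp hv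
    obtain ⟨a, rfl⟩ := Submodule.mem_span_singleton.mp hy
    rw [map_add, map_smul]
    refine Submodule.mem_sup_right (add_mem (Submodule.smul_mem _ _ ?_) (hQ i j h z hz))
    have := slE_mem_eigenspace hρ hwμ i j h.ne
    have hk : μ + ((j : ℂ) - i) = μ + (((j - i - 1 : ℕ) : ℂ) + 1) := by
      have h' : (i : ℕ) < j := h
      rw [Nat.cast_sub (by omega), Nat.cast_sub (by omega)]; push_cast; ring
    rw [hk] at this
    exact (le_iSup (fun k : ℕ => T.eigenspace (μ + (k + 1))) _) this
  obtain ⟨y, hy, z, hz, rfl⟩ := Submodule.mem_sup.mp (hle hv)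
  obtain ⟨a, rfl⟩ := Submodule.mem_span_singleton.mp hy
  refine ⟨a, ?_⟩
  have hzμ : z ∈ T.eigenspace μ := by
    have := sub_mem hv' (Submodule.smul_mem _ a hwμ)
    rwa [add_sub_cancel_left] at this
  have hQle : Q ≤ ⨆ j, ⨆ (_ : j ≠ μ), T.eigenspace j := by
    refine iSup_le fun k => le_iSup₂_of_le (μ + (k + 1)) ?_ le_rfl
    intro h
    have : ((k : ℂ) + 1) = 0 := by simpa using h
    exact Nat.cast_add_one_ne_zero k this
  have := (Submodule.disjoint_def.mp (T.eigenspaces_iSupIndep μ)) z hzμ (hQle hz)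
  rw [this, add_zero]

/-- The direct sum of two representations. -/
def prodRep {L : Type*} [LieRing L] [LieAlgebra ℂ L] (ρ : L →ₗ[ℂ] Module.End ℂ V)
    (σ : L →ₗ[ℂ] Module.End ℂ W) : L →ₗ[ℂ] Module.End ℂ (V × W) where
  toFun x := (ρ x).prodMap (σ x)
  map_add' x y := by ext <;> simp
  map_smul' c x := by ext <;> simp

@[simp]
theorem prodRep_apply {L : Type*} [LieRing L] [LieAlgebra ℂ L] (ρ : L →ₗ[ℂ] Module.End ℂ V)
    (σ : L →ₗ[ℂ] Module.End ℂ W) (x : L) (v : V × W) : prodRep ρ σ x v = (ρ x v.1, σ x v.2) := rfl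

/-- The submodule `G` of `V × W` generated by `(v, w)` is the graph of an equivalence. By
irreducibility both projections are onto, and `G` meets each factor in zero or in the whole factor.
In the latter case `(v, 0)` or `(0, w)` would lie in `G` with the lowest eigenvalue and so be a
multiple of `(v, w)`, which is impossible. -/
theorem intertwined_of_isLowest {ρ : SL n →ₗ[ℂ] Module.End ℂ V} {σ : SL n →ₗ[ℂ] Module.End ℂ W}
    (hρ : IsLieRep ρ) (hσ : IsLieRep σ) (iρ : IsIrred ρ) (iσ : IsIrred σ) {v : V} {w : W}
    {χ : SL n → ℂ} (hv0 : v ≠ 0) (hw0 : w ≠ 0) (hv : IsLowest ρ v χ) (hw : IsLowest σ w χ) :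
    Intertwined ρ σ := by
  have hτ : IsLieRep (prodRep ρ σ) := by
    intro x y
    apply LinearMap.ext
    rintro ⟨a, b⟩
    simp [hρ x y, hσ x y]
  have hvw : IsLowest (prodRep ρ σ) (v, w) χ :=
    ⟨fun D hD => by simp [hv.diag D hD, hw.diag D hD],
      fun i j h => by simp [hv.lower i j h, hw.lower i j h]⟩
  let G := upperSpan (prodRep ρ σ) (v, w)
  have hG : ∀ x, ∀ u ∈ G, prodRep ρ σ x u ∈ G := fun x u hu => upperSpan_invariant hτ hvw x hu
  have hmem : (v, w) ∈ G := mem_upperSpan _ _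
  have hfst : G.map (LinearMap.fst ℂ V W) = ⊤ := by
    refine (iρ.2 _ ?_).resolve_left fun h => hv0 ?_
    · rintro x _ ⟨u, hu, rfl⟩
      exact ⟨_, hG x u hu, rfl⟩
    · rw [← Submodule.mem_bot ℂ, ← h]
      exact ⟨_, hmem, rfl⟩
  have hsnd : G.map (LinearMap.snd ℂ V W) = ⊤ := by
    refine (iσ.2 _ ?_).resolve_left fun h => hw0 ?_
    · rintro x _ ⟨u, hu, rfl⟩
      exact ⟨_, hG x u hu, rfl⟩
    · rw [← Submodule.mem_bot ℂ, ← h]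
      exact ⟨_, hmem, rfl⟩
  have hinl : G.comap (LinearMap.inl ℂ V W) = ⊥ := by
    refine (iρ.2 _ ?_).resolve_right fun h => hw0 ?_
    · intro x u hu
      simpa using hG x _ hu
    · have h1 : (v, (0 : W)) ∈ G := (h ▸ Submodule.mem_top : v ∈ G.comap (LinearMap.inl ℂ V W))
      obtain ⟨a, ha⟩ := upperSpan_inf_eigenspace hτ hvw h1 (by
        rw [Module.End.mem_eigenspace_iff]
        simp [hv.diag _ gradingElt_isDiag])
      simp only [Prod.smul_mk, Prod.mk.injEq] at ha
      rcases smul_eq_zero.mp ha.2 with h | h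
      · exact absurd (by simpa [h] using ha.1.symm) hv0
      · exact h
  have hinr : G.comap (LinearMap.inr ℂ V W) = ⊥ := by
    refine (iσ.2 _ ?_).resolve_right fun h => hv0 ?_
    · intro x u hu
      simpa using hG x _ hu
    · have h1 : ((0 : V), w) ∈ G := (h ▸ Submodule.mem_top : w ∈ G.comap (LinearMap.inr ℂ V W))
      obtain ⟨a, ha⟩ := upperSpan_inf_eigenspace hτ hvw h1 (by
        rw [Module.End.mem_eigenspace_iff]
        simp [hw.diag _ gradingElt_isDiag])
      simp only [Prod.smul_mk, Prod.mk.injEq] at ha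
      rcases smul_eq_zero.mp ha.1 with h | h
      · exact absurd (by simpa [h] using ha.2.symm) hw0
      · exact h
  let p₁ : G →ₗ[ℂ] V := LinearMap.fst ℂ V W ∘ₗ G.subtype
  let p₂ : G →ₗ[ℂ] W := LinearMap.snd ℂ V W ∘ₗ G.subtype
  have hb₁ : Function.Bijective p₁ := by
    constructor
    · rw [injective_iff_map_eq_zero]
      rintro ⟨⟨a, b⟩, hab⟩ h
      have ha : a = 0 := h
      subst ha
      have : b ∈ G.comap (LinearMap.inr ℂ V W) := hab
      rw [hinr, Submodule.mem_bot] at this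
      subst this
      rfl
    · intro a
      obtain ⟨u, hu, rfl⟩ : a ∈ G.map (LinearMap.fst ℂ V W) := hfst ▸ Submodule.mem_top
      exact ⟨⟨u, hu⟩, rfl⟩
  have hb₂ : Function.Bijective p₂ := by
    constructor
    · rw [injective_iff_map_eq_zero]
      rintro ⟨⟨a, b⟩, hab⟩ h
      have ha : b = 0 := h
      subst ha
      have : a ∈ G.comap (LinearMap.inl ℂ V W) := hab
      rw [hinl, Submodule.mem_bot] at this
      subst this
      rfl
    · intro a
      obtain ⟨u, hu, rfl⟩ : a ∈ G.map (LinearMap.snd ℂ V W) := hsnd ▸ Submodule.mem_top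
      exact ⟨⟨u, hu⟩, rfl⟩
  refine ⟨(LinearEquiv.ofBijective p₁ hb₁).symm.trans (LinearEquiv.ofBijective p₂ hb₂),
    fun x a => ?_⟩
  obtain ⟨u, rfl⟩ := (LinearEquiv.ofBijective p₁ hb₁).surjective a
  have : ρ x (LinearEquiv.ofBijective p₁ hb₁ u)
      = LinearEquiv.ofBijective p₁ hb₁ ⟨prodRep ρ σ x u, hG x u u.2⟩ := rfl
  rw [this]
  simp only [LinearEquiv.trans_apply, LinearEquiv.symm_apply_apply]
  rfl

/-- The contragredient of an irreducible representation of `sl(n, ℂ)` is its twist by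
`X ↦ -Xᵀ`. -/
theorem intertwined_outI_dual [FiniteDimensional ℂ V] {ρ : SL n →ₗ[ℂ] Module.End ℂ V}
    (hρ : IsLieRep ρ) (iρ : IsIrred ρ) :
    Intertwined (ρ ∘ₗ ((outI n).toLinearEquiv : SL n →ₗ[ℂ] SL n)) (dualRep ρ) := by
  have := iρ.1
  set ρ' := ρ ∘ₗ ((outI n).toLinearEquiv : SL n →ₗ[ℂ] SL n) with hρ'
  have e' : ∀ X, ρ' X = ρ (outI n X) := fun X => rfl
  obtain ⟨w, χ, hw0, hw⟩ := exists_isLowest (hρ.comp (outI n))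
  obtain ⟨f, χ', hf0, hf⟩ := exists_isLowest hρ.dual
  have htop : upperSpan ρ' w = ⊤ := by
    refine ((iρ.comp (outI n)).2 _ fun X v hv =>
      upperSpan_invariant (hρ.comp (outI n)) hw X hv).resolve_left fun h => hw0 ?_
    rw [← Submodule.mem_bot ℂ, ← h]
    exact mem_upperSpan _ _
  -- As `f` is lowest for the dual, it vanishes on the images of all `ρ' (E_{ij})`, `i < j`. If it
  -- also vanished at `w`, its kernel would contain the span of `w`, which is all of `V`.
  have hfw : f w ≠ 0 := by
    intro h
    refine hf0 (LinearMap.ker_eq_top.mp (top_le_iff.mp (htop ▸ upperSpan_le h ?_)))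
    intro i j hij v _
    have := LinearMap.congr_fun (hf.lower j i hij) v
    rw [LinearMap.mem_ker, e', outI_slE]
    simpa using this
  refine intertwined_of_isLowest (hρ.comp (outI n)) hρ.dual (iρ.comp (outI n)) iρ.dual hw0 hf0 hw
    ⟨fun D hD => ?_, hf.lower⟩
  rw [hf.diag D hD]
  congr 1
  -- Both weights are read off from `f (ρ D w)`: it equals `-χ' D * f w` and also `-χ D * f w`, and
  -- `f w ≠ 0`.
  have h1 := hw.diag D hD
  change ρ' D w = _ at h1
  rw [e', outI_of_isDiag hD] at h1
  have h2 := LinearMap.congr_fun (hf.diag D hD) w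
  have h3 := congrArg f h1
  simp at h2 h3
  rw [h3] at h2
  exact (mul_right_cancel₀ hfw h2).symm

end Lowest

/-! ### Twisting by inner automorphisms -/

section TruncatedExp

variable {A : Type*} [Ring A] [Algebra ℂ A]

/-- Partial sums of the exponential series. -/
def expSum (e : A) (N : ℕ) : A := ∑ k ∈ Finset.range N, ((k.factorial : ℂ)⁻¹) • e ^ k

theorem expSum_succ (e : A) (N : ℕ) :
    expSum e (N + 1) = expSum e N + ((N.factorial : ℂ)⁻¹) • e ^ N :=
  Finset.sum_range_succ _ _

/-- This is the Leibniz expansion of `eᴺ x` in iterated commutators, which stops after the second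
one because `z` commutes with `e`. Writing `N = k + 2` avoids truncated subtraction. -/
theorem pow_mul_of_commutators {e x y z : A} (hx : e * x = x * e + y) (hy : e * y = y * e + z)
    (hz : e * z = z * e) (k : ℕ) :
    e ^ (k + 2) * x = x * e ^ (k + 2) + ((k : ℂ) + 2) • (y * e ^ (k + 1))
      + (((k : ℂ) + 2) * (k + 1) / 2) • (z * e ^ k) := by
  induction k with
  | zero =>
    have : e ^ 2 * x = x * e ^ 2 + y * e + y * e + z := by
      rw [pow_two, mul_assoc, hx, mul_add, ← mul_assoc, hx, hy]; noncomm_ring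
    simp only [zero_add, this, pow_one, pow_zero, mul_one, Nat.cast_zero, two_smul]
    norm_num
    abel
  | succ k ih =>
    have h0 : e ^ (k + 1 + 2) * x = e * (e ^ (k + 2) * x) := by rw [← mul_assoc, ← pow_succ']
    have h1 : e * (x * e ^ (k + 2)) = x * e ^ (k + 1 + 2) + y * e ^ (k + 1 + 1) := by
      rw [← mul_assoc, hx, add_mul, mul_assoc, ← pow_succ']
    have h2 : e * (y * e ^ (k + 1)) = y * e ^ (k + 1 + 1) + z * e ^ (k + 1) := by
      rw [← mul_assoc, hy, add_mul, mul_assoc, ← pow_succ']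
    have h3 : e * (z * e ^ k) = z * e ^ (k + 1) := by
      rw [← mul_assoc, hz, mul_assoc, ← pow_succ']
    rw [h0, ih, mul_add, mul_add, mul_smul_comm, mul_smul_comm, h1, h2, h3]
    push_cast
    module

/-- A truncated form of `exp(e) x = (x + y + z/2) exp(e)`. Division by factorials turns the binomial
coefficients of the Leibniz expansion into shorter partial sums, one term shorter for each
commutator. -/
theorem expSum_mul_of_commutators {e x y z : A} (hx : e * x = x * e + y)
    (hy : e * y = y * e + z) (hz : e * z = z * e) (N : ℕ) :
    expSum e (N + 2) * x
      = x * expSum e (N + 2) + y * expSum e (N + 1) + (1 / 2 : ℂ) • (z * expSum e N) := by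
  induction N with
  | zero => simp [expSum, Finset.sum_range_succ, add_mul, mul_add, hx]; abel
  | succ N ih =>
    rw [expSum_succ e (N + 2), add_mul, ih, smul_mul_assoc, pow_mul_of_commutators hx hy hz,
      expSum_succ e (N + 1), expSum_succ e N]
    simp only [mul_add x, mul_add y, mul_add z, mul_smul_comm, smul_add, smul_smul]
    have f1 : (((N + 2).factorial : ℂ)⁻¹) * ((N : ℂ) + 2) = ((N + 1).factorial : ℂ)⁻¹ := by
      rw [Nat.factorial_succ (N + 1)]
      have : ((N + 1).factorial : ℂ) ≠ 0 := by exact_mod_cast Nat.factorial_ne_zero _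
      have h2 : (N : ℂ) + 2 ≠ 0 := by exact_mod_cast (by omega : N + 2 ≠ 0)
      push_cast
      rw [show (N : ℂ) + 1 + 1 = N + 2 by ring]
      field_simp
    have f2 : (((N + 1).factorial : ℂ)⁻¹) * ((N : ℂ) + 1) = (N.factorial : ℂ)⁻¹ := by
      rw [Nat.factorial_succ N]
      have : (N.factorial : ℂ) ≠ 0 := by exact_mod_cast Nat.factorial_ne_zero _
      have h2 : (N : ℂ) + 1 ≠ 0 := by exact_mod_cast (by omega : N + 1 ≠ 0)
      push_cast
      field_simp
    have f3 : (((N + 2).factorial : ℂ)⁻¹) * (((N : ℂ) + 2) * (N + 1) / 2)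
        = 1 / 2 * (N.factorial : ℂ)⁻¹ := by
      rw [← f2, ← f1]; ring
    rw [f1, f3]
    abel

theorem expSum_eq_of_pow_eq_zero {e : A} {K : ℕ} (h : e ^ K = 0) (d : ℕ) :
    expSum e (K + d) = expSum e K := by
  induction d with
  | zero => rfl
  | succ d ih => rw [← add_assoc, expSum_succ, ih, pow_add, h, zero_mul, smul_zero, add_zero]

theorem isUnit_expSum_succ {e : A} (he : IsNilpotent e) (K : ℕ) : IsUnit (expSum e (K + 1)) := by
  have : expSum e (K + 1)
      = e * (∑ k ∈ Finset.range K, (((k + 1).factorial : ℂ)⁻¹) • e ^ k) + 1 := by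
    rw [expSum, Finset.sum_range_succ', Finset.mul_sum]
    simp [pow_succ']
  rw [this]
  refine IsNilpotent.isUnit_add_one (Commute.isNilpotent_mul_right ?_ he)
  exact Commute.sum_right _ _ _ fun k _ => ((Commute.refl e).pow_right k).smul_right _

/-- If `(ad e)³ x = 0` and `e` is nilpotent, the exponential of `e` conjugates `x` to
`x + [e, x] + [e, [e, x]] / 2`. -/
theorem exists_isUnit_conj {e : A} (he : IsNilpotent e) :
    ∃ U : A, IsUnit U ∧ ∀ x y z, e * x = x * e + y → e * y = y * e + z → e * z = z * e →
      U * x = (x + y + (1 / 2 : ℂ) • z) * U := by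
  obtain ⟨K, hK⟩ := he
  have hK1 : e ^ (K + 1) = 0 := by rw [pow_succ, hK, zero_mul]
  refine ⟨expSum e (K + 1), isUnit_expSum_succ ⟨K, hK⟩ K, fun x y z hx hy hz => ?_⟩
  have := expSum_mul_of_commutators hx hy hz (K + 1)
  rw [expSum_eq_of_pow_eq_zero hK1 2, expSum_eq_of_pow_eq_zero hK1 1] at this
  rw [this, add_mul, add_mul, smul_mul_assoc]

end TruncatedExp

/-- Commutation with `h` multiplies `e ^ k` by `k c`. If no power vanished, this operator on the
finite-dimensional space of endomorphisms would have infinitely many eigenvalues. -/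
theorem isNilpotent_of_commutator_eq_smul {V : Type*} [AddCommGroup V] [Module ℂ V]
    [FiniteDimensional ℂ V] {h e : Module.End ℂ V} {c : ℂ} (hc : c ≠ 0)
    (he : h * e - e * h = c • e) : IsNilpotent e := by
  by_contra hnil
  let T : Module.End ℂ (Module.End ℂ V) := LinearMap.mulLeft ℂ h - LinearMap.mulRight ℂ h
  have hT : ∀ k : ℕ, T (e ^ k) = ((k : ℂ) * c) • e ^ k := by
    intro k
    induction k with
    | zero => simp [T]
    | succ k ih =>
      have : T (e ^ (k + 1)) = T (e ^ k) * e + e ^ k * (h * e - e * h) := by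
        simp only [T, LinearMap.sub_apply, LinearMap.mulLeft_apply, LinearMap.mulRight_apply,
          pow_succ]
        noncomm_ring
      rw [this, ih, he, smul_mul_assoc, mul_smul_comm, ← pow_succ, ← add_smul]
      push_cast
      congr 1
      ring
  have hfin : Set.Finite {c | T.HasEigenvalue c} := Module.End.finite_hasEigenvalue T
  refine Set.infinite_of_injective_forall_mem (f := fun k : ℕ => (k : ℂ) * c) ?_ ?_ hfin
  · intro a b hab
    exact_mod_cast mul_right_cancel₀ hc hab
  · intro k
    exact Module.End.hasEigenvalue_of_hasEigenvector (x := e ^ k)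
      ⟨Module.End.mem_eigenspace_iff.mpr (hT k), fun h => hnil ⟨k, h⟩⟩

/-! ### Implementing conjugations by operators on a representation. -/

section Inner

open Matrix

variable {n : ℕ}

/-- Conjugation by an element of `SL(n, ℂ)`. -/
def conjSL (A : SpecialLinearGroup (Fin n) ℂ) (X : SL n) : SL n :=
  ⟨A.val * X.val * (A⁻¹).val, by
    have h : X.val.trace = 0 := X.property
    change trace (A.val * X.val * (A⁻¹).val) = 0
    have h1 : (A⁻¹).val * A.val = 1 := congrArg Subtype.val (inv_mul_cancel A)
    rw [trace_mul_comm, ← mul_assoc, h1, one_mul, h]⟩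

theorem conjSL_mul (A B : SpecialLinearGroup (Fin n) ℂ) (X : SL n) :
    conjSL (A * B) X = conjSL A (conjSL B X) := by
  apply Subtype.ext
  change (A * B).val * X.val * ((A * B)⁻¹).val
    = A.val * (B.val * X.val * (B⁻¹).val) * (A⁻¹).val
  rw [_root_.mul_inv_rev]
  change A.val * B.val * X.val * ((B⁻¹).val * (A⁻¹).val) = _
  noncomm_ring

/-- For `s = b E_{ij}` one has `s² = 0`, so `(1 + s) X (1 - s) = X + [s, X] - s X s` and `[s, [s,
X]] = -2 s X s`. The result is the exponential of `ad s`, in the form supplied by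
`exists_isUnit_conj`. -/
theorem conjSL_transvection {i j : Fin n} (hij : i ≠ j) (b : ℂ) (X : SL n) :
    conjSL (SpecialLinearGroup.transvection hij b) X
      = X + ⁅b • slE i j hij, X⁆ + (1 / 2 : ℂ) • ⁅b • slE i j hij, ⁅b • slE i j hij, X⁆⁆ := by
  apply Subtype.ext
  have hsq : single i j b * single i j b = 0 := single_mul_single_of_ne _ _ _ _ hij.symm _
  set s := single i j b with hs
  have hval : (b • slE i j hij).val = s := by
    change b • single i j (1 : ℂ) = _
    rw [smul_single, smul_eq_mul, mul_one]
  change (SpecialLinearGroup.transvection hij b).val * X.val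
      * ((SpecialLinearGroup.transvection hij b)⁻¹).val
    = X.val + (⁅b • slE i j hij, X⁆ : SL n).val
      + (1 / 2 : ℂ) • (⁅b • slE i j hij, (⁅b • slE i j hij, X⁆ : SL n)⁆ : SL n).val
  rw [SpecialLinearGroup.transvection_inv, sl_bracket_val, sl_bracket_val, hval,
    SpecialLinearGroup.transvection_coe, SpecialLinearGroup.transvection_coe, ← single_neg, ← hs,
    sl_bracket_val, hval]
  have : s * (s * X.val - X.val * s) - (s * X.val - X.val * s) * s
      = (2 : ℂ) • -(s * X.val * s) := by
    have e : s * (s * X.val - X.val * s) - (s * X.val - X.val * s) * s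
      = s * s * X.val - s * X.val * s - s * X.val * s + X.val * (s * s) := by noncomm_ring
    rw [e, hsq, two_smul]
    noncomm_ring
  rw [this, smul_smul]
  norm_num
  noncomm_ring

theorem lie_lie_lie_slE {i j : Fin n} (hij : i ≠ j) (b : ℂ) (X : SL n) :
    ⁅b • slE i j hij, ⁅b • slE i j hij, ⁅b • slE i j hij, X⁆⁆⁆ = 0 := by
  apply Subtype.ext
  have hsq : single i j b * single i j b = 0 := single_mul_single_of_ne _ _ _ _ hij.symm _
  set s := single i j b with hs
  have hval : (b • slE i j hij).val = s := by
    change b • single i j (1 : ℂ) = _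
    rw [smul_single, smul_eq_mul, mul_one]
  rw [sl_bracket_val, sl_bracket_val, sl_bracket_val, hval]
  change _ = (0 : Matrix (Fin n) (Fin n) ℂ)
  have e : s * (s * (s * X.val - X.val * s) - (s * X.val - X.val * s) * s)
      - (s * (s * X.val - X.val * s) - (s * X.val - X.val * s) * s) * s
    = (s * s) * s * X.val - 3 * ((s * s) * X.val * s) + 3 * (s * X.val * (s * s))
      - X.val * (s * (s * s)) := by noncomm_ring
  rw [e, hsq]
  simp

/-- Whitehead's factorisation: with `w(a) = e_{ij}(a) e_{ji}(-a⁻¹) e_{ij}(a)`, the diagonal matrix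
is `w(a) w(-1)`. It reduces the generators of the special linear group to transvections. -/
theorem diag2n_eq_prod {i j : Fin n} (hij : i ≠ j) {a : ℂ} (ha : a ≠ 0) :
    SpecialLinearGroup.diag2n hij a ha
      = SpecialLinearGroup.transvection hij a * SpecialLinearGroup.transvection hij.symm (-a⁻¹) *
        SpecialLinearGroup.transvection hij a * SpecialLinearGroup.transvection hij (-1) *
        SpecialLinearGroup.transvection hij.symm 1 *
        SpecialLinearGroup.transvection hij (-1) := by
  apply Subtype.ext
  have hd : (SpecialLinearGroup.diag2n hij a ha).val
      = 1 + single i i (a - 1) + single j j (a⁻¹ - 1) := by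
    rw [SpecialLinearGroup.diag2n_coe]
    ext k l
    by_cases hkl : k = l
    · subst hkl
      by_cases hki : k = i
      · subst hki; simp [hij.symm]
      · by_cases hkj : k = j
        · subst hkj; simp [hij, hki]
        · simp [hki, hkj, Ne.symm hki, Ne.symm hkj]
    · have h1 : ¬ (i = k ∧ i = l) := fun h => hkl (h.1.symm.trans h.2)
      have h2 : ¬ (j = k ∧ j = l) := fun h => hkl (h.1.symm.trans h.2)
      simp [hkl, h1, h2]
  rw [hd]
  change _ = (1 + single i j a) * (1 + single j i (-a⁻¹)) * (1 + single i j a)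
    * (1 + single i j (-1)) * (1 + single j i 1) * (1 + single i j (-1))
  simp only [sub_eq_add_neg, single_add, ← single_neg]
  simp [mul_add, add_mul, hij, hij.symm, ha]
  abel

variable {V : Type*} [AddCommGroup V] [Module ℂ V] [FiniteDimensional ℂ V]

/-- The operator is the exponential of `ρ Y` with `Y = b E_{ij}`. The relation `[H, Y] = 2 Y` for `H
= E_{ii} - E_{jj}` makes `ρ Y` nilpotent, and `(ad Y)³ = 0` makes the conjugation formula exact. -/
theorem exists_conj_transvection {ρ : SL n →ₗ[ℂ] Module.End ℂ V} (hρ : IsLieRep ρ)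
    {i j : Fin n} (hij : i ≠ j) (b : ℂ) :
    ∃ R : V ≃ₗ[ℂ] V, ∀ X v,
      R (ρ X v) = ρ (conjSL (SpecialLinearGroup.transvection hij b) X) (R v) := by
  obtain ⟨Y, hY⟩ : ∃ Y : SL n, Y = b • slE i j hij := ⟨_, rfl⟩
  let H : SL n := LieAlgebra.SpecialLinear.singleSubSingle i j 1
  have hH : H.val.IsDiag := by
    intro k l hkl
    change (single i i (1 : ℂ) - single j j 1 : Matrix (Fin n) (Fin n) ℂ) k l = 0
    have h1 : ¬ (i = k ∧ i = l) := fun h => hkl (h.1.symm.trans h.2)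
    have h2 : ¬ (j = k ∧ j = l) := fun h => hkl (h.1.symm.trans h.2)
    simp [h1, h2]
  have hHY : ⁅H, Y⁆ = (2 : ℂ) • Y := by
    rw [hY, lie_smul, lie_slE_of_isDiag hH, smul_comm]
    congr 1
    change (single i i (1 : ℂ) - single j j 1 : Matrix (Fin n) (Fin n) ℂ) i i
      - (single i i (1 : ℂ) - single j j 1 : Matrix (Fin n) (Fin n) ℂ) j j = 2
    simp [hij, hij.symm]
    norm_num
  have hnil : IsNilpotent (ρ Y) := isNilpotent_of_commutator_eq_smul (h := ρ H) two_ne_zero (by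
    rw [← hρ, hHY, map_smul])
  obtain ⟨U, hU, hconj⟩ := exists_isUnit_conj hnil
  refine ⟨LinearEquiv.ofBijective U ((Module.End.isUnit_iff U).mp hU), fun X v => ?_⟩
  have hbr : ∀ Z, ρ Y * ρ Z = ρ Z * ρ Y + ρ ⁅Y, Z⁆ := fun Z => by rw [hρ Y Z]; abel
  have := hconj (ρ X) (ρ ⁅Y, X⁆) (ρ ⁅Y, ⁅Y, X⁆⁆) (hbr _) (hbr _) (by
    rw [hbr, hY, lie_lie_lie_slE, map_zero, add_zero])
  rw [conjSL_transvection, ← hY]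
  have := LinearMap.congr_fun this v
  simpa using this

theorem exists_conj {ρ : SL n →ₗ[ℂ] Module.End ℂ V} (hρ : IsLieRep ρ) [Nontrivial (Fin n)]
    (A : SpecialLinearGroup (Fin n) ℂ) :
    ∃ R : V ≃ₗ[ℂ] V, ∀ X v, R (ρ X v) = ρ (conjSL A X) (R v) := by
  have hmul : ∀ A B : SpecialLinearGroup (Fin n) ℂ,
      (∃ R : V ≃ₗ[ℂ] V, ∀ X v, R (ρ X v) = ρ (conjSL A X) (R v)) →
      (∃ R : V ≃ₗ[ℂ] V, ∀ X v, R (ρ X v) = ρ (conjSL B X) (R v)) →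
      ∃ R : V ≃ₗ[ℂ] V, ∀ X v, R (ρ X v) = ρ (conjSL (A * B) X) (R v) := by
    rintro A B ⟨R, hR⟩ ⟨S, hS⟩
    exact ⟨S.trans R, fun X v => by
      rw [LinearEquiv.trans_apply, hS, hR, conjSL_mul, LinearEquiv.trans_apply]⟩
  refine SpecialLinearGroup.diagonal_transvection_induction' _ A (fun i j hij c hc => ?_)
    (fun i j hij a => exists_conj_transvection hρ hij a) hmul
  rw [diag2n_eq_prod]
  refine hmul _ _ (hmul _ _ (hmul _ _ (hmul _ _ (hmul _ _ ?_ ?_) ?_) ?_) ?_) ?_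
  all_goals exact exists_conj_transvection hρ _ _

theorem subsingleton_SL [Subsingleton (Fin n)] : Subsingleton (SL n) := by
  refine ⟨fun X Y => Subtype.ext ?_⟩
  ext i j
  have hX : X.val.trace = 0 := X.property
  have hY : Y.val.trace = 0 := Y.property
  rw [Subsingleton.elim j i]
  rw [trace, Fintype.sum_subsingleton _ i] at hX hY
  exact hX.trans hY.symm

theorem intertwined_of_conj {ρ : SL n →ₗ[ℂ] Module.End ℂ V} (hρ : IsLieRep ρ)
    {g g' : SL n ≃ₗ⁅ℂ⁆ SL n} (A : SpecialLinearGroup (Fin n) ℂ)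
    (hA : ∀ X, g X = conjSL A (g' X)) :
    Intertwined (ρ ∘ₗ (g.toLinearEquiv : SL n →ₗ[ℂ] SL n))
      (ρ ∘ₗ (g'.toLinearEquiv : SL n →ₗ[ℂ] SL n)) := by
  rcases subsingleton_or_nontrivial (Fin n) with h | h
  · have := subsingleton_SL (n := n)
    exact ⟨LinearEquiv.refl ℂ V, fun X v => by rw [Subsingleton.elim X 0]; simp⟩
  · obtain ⟨R, hR⟩ := exists_conj hρ A
    refine Intertwined.symm ⟨R, fun X v => ?_⟩
    change R (ρ (g' X) v) = ρ (g X) (R v)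
    rw [hR, hA]

end Inner

/-! ### Automorphisms of `sl(n, ℂ)` -/

section Extremal

open Matrix

variable {n : ℕ}

/-- Elements `X` with `[X, [X, Y]] ∈ ℂ X` for all `Y`. -/
def IsExtremal (X : SL n) : Prop := ∀ Y : SL n, ∃ c : ℂ, ⁅X, ⁅X, Y⁆⁆ = c • X

theorem lie_lie_val (X Y : SL n) : (⁅X, (⁅X, Y⁆ : SL n)⁆ : SL n).val
    = X.val * X.val * Y.val - (2 : ℂ) • (X.val * Y.val * X.val) + Y.val * (X.val * X.val) := by
  rw [sl_bracket_val, sl_bracket_val, two_smul]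
  noncomm_ring

theorem IsExtremal.map {X : SL n} (hX : IsExtremal X) (g : SL n ≃ₗ⁅ℂ⁆ SL n) :
    IsExtremal (g X) := by
  intro Y
  obtain ⟨c, hc⟩ := hX (g.symm Y)
  refine ⟨c, ?_⟩
  have := congrArg g hc
  rwa [LieEquiv.map_lie, LieEquiv.map_lie, LieEquiv.apply_symm_apply, map_smul] at this

theorem isExtremal_of_eq_vecMulVec {X : SL n} {x f : Fin n → ℂ} (h : X.val = vecMulVec x f) :
    IsExtremal X := by
  have hX : X.val.trace = 0 := X.property
  rw [h, trace_vecMulVec] at hX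
  have hsq : X.val * X.val = 0 := by
    rw [h, vecMulVec_mul_vecMulVec, dotProduct_comm, hX, zero_smul, vecMulVec_zero]
  intro Y
  refine ⟨-(2 * (f ⬝ᵥ (Y.val *ᵥ x))), Subtype.ext ?_⟩
  change _ = (-(2 * (f ⬝ᵥ (Y.val *ᵥ x)))) • X.val
  rw [lie_lie_val, hsq, zero_mul, mul_zero, zero_sub, add_zero, mul_assoc, h, mul_vecMulVec,
    vecMulVec_mul_vecMulVec, vecMulVec_smul, smul_smul, neg_smul]

/-- Subtracting a scalar matrix from `Y` does not change commutators, so arbitrary test matrices are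
allowed. -/
theorem IsExtremal.exists_mul {X : SL n} (hX : IsExtremal X) (hn : n ≠ 0)
    (Y : Matrix (Fin n) (Fin n) ℂ) : ∃ c : ℂ,
      X.val * X.val * Y - (2 : ℂ) • (X.val * Y * X.val) + Y * (X.val * X.val) = c • X.val := by
  have hn' : (n : ℂ) ≠ 0 := by exact_mod_cast hn
  have htr : (Y - (Y.trace / n) • (1 : Matrix (Fin n) (Fin n) ℂ)).trace = 0 := by
    simp [hn']
  obtain ⟨c, hc⟩ := hX ⟨_, htr⟩
  refine ⟨c, ?_⟩
  have := congrArg Subtype.val hc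
  rw [lie_lie_val] at this
  change _ = c • X.val at this
  rw [← this]
  simp only [mul_sub, sub_mul, mul_smul_comm, smul_mul_assoc, mul_one, one_mul, smul_sub, two_smul]
  abel

/-- For an eigenvalue `l` of `X` with eigenvector `u`, put `N = X - l`. If `N² = 0`, then `N` has
trace zero, so `l = 0`. Otherwise the test matrix `Y = u eᵢᵀ` has `N Y = 0`, and the double
commutator reduces to `Y N² = u ψ` with `ψ ≠ 0` a row of `N²`. Then `X` is proportional to `u ψ`,
and a rank-one matrix of trace zero has square zero. -/
theorem IsExtremal.mul_self_eq_zero {X : SL n} (hX : IsExtremal X) (hn : n ≠ 0) :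
    X.val * X.val = 0 := by
  have htr : X.val.trace = 0 := X.property
  have hn' : (n : ℂ) ≠ 0 := by exact_mod_cast hn
  have : NeZero n := ⟨hn⟩
  obtain ⟨l, hl⟩ := Module.End.exists_eigenvalue (toLin' X.val)
  obtain ⟨u, hu, hu0⟩ := hl.exists_hasEigenvector
  rw [Module.End.mem_eigenspace_iff, toLin'_apply] at hu
  set N := X.val - l • (1 : Matrix (Fin n) (Fin n) ℂ) with hN
  have hXN : X.val = N + l • 1 := by rw [hN]; abel
  by_cases hN2 : N * N = 0
  · have h1 : IsNilpotent N := ⟨2, by rw [pow_two, hN2]⟩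
    have h2 := (isNilpotent_trace_of_isNilpotent h1).eq_zero
    have hl0 : l = 0 := by
      rw [hN, trace_sub, htr, trace_smul, trace_one] at h2
      simpa [hn'] using h2
    rw [hXN, hl0, zero_smul, add_zero, hN2]
  · obtain ⟨i, j, hij⟩ : ∃ i j, (N * N) i j ≠ 0 := by
      by_contra! h
      exact hN2 (Matrix.ext h)
    set ψ : Fin n → ℂ := (Pi.single i 1 : Fin n → ℂ) ᵥ* (N * N) with hψ
    have hψj : ψ j ≠ 0 := by simpa [hψ] using hij
    obtain ⟨c, hc⟩ := hX.exists_mul hn (vecMulVec u (Pi.single i 1))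
    have hNu : N *ᵥ u = 0 := by
      rw [hN, sub_mulVec, hu, smul_mulVec, one_mulVec, sub_self]
    have hNY : N * vecMulVec u (Pi.single i 1) = 0 := by
      rw [mul_vecMulVec, hNu, zero_vecMulVec]
    have key : vecMulVec u ψ = c • X.val := by
      rw [← hc, hψ, ← vecMulVec_mul, hXN]
      set Y : Matrix (Fin n) (Fin n) ℂ := vecMulVec u (Pi.single i 1)
      simp only [add_mul, mul_add, smul_mul_assoc, mul_smul_comm, one_mul, mul_one, mul_assoc, hNY,
        mul_zero, smul_zero, zero_add, add_zero]
      module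
    have hc0 : c ≠ 0 := by
      rintro rfl
      rw [zero_smul, vecMulVec_eq_zero] at key
      rcases key with h | h
      · exact hu0 h
      · exact hψj (by rw [h]; rfl)
    have hX' : X.val = c⁻¹ • vecMulVec u ψ := by rw [key, smul_smul, inv_mul_cancel₀ hc0, one_smul]
    have h0 : u ⬝ᵥ ψ = 0 := by
      have := htr
      rw [hX', trace_smul, trace_vecMulVec] at this
      simpa [hc0] using this
    rw [hX', smul_mul_smul_comm, vecMulVec_mul_vecMulVec, dotProduct_comm, h0, zero_smul,
      vecMulVec_zero, smul_zero]

/-- Since `X² = 0`, testing with `E_{ba}` gives `-2 X E_{ba} X = c X`, whose left side is a column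
of `X` times a row of `X`. Its `(a, b)` entry is `-2 X_{ab}²`, so `c ≠ 0` when `X_{ab} ≠ 0`. -/
theorem IsExtremal.exists_eq_vecMulVec {X : SL n} (hX : IsExtremal X) (hn : n ≠ 0) :
    ∃ y h, X.val = vecMulVec y h := by
  by_cases hX0 : X.val = 0
  · exact ⟨0, 0, by simp [hX0]⟩
  obtain ⟨a, b, hab⟩ : ∃ a b, X.val a b ≠ 0 := by
    by_contra! h
    exact hX0 (Matrix.ext h)
  obtain ⟨c, hc⟩ := hX.exists_mul hn (single b a 1)
  rw [hX.mul_self_eq_zero hn, zero_mul, mul_zero, zero_sub, add_zero] at hc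
  have hent : ∀ k l, -(2 * (X.val k b * X.val a l)) = c * X.val k l := by
    intro k l
    have := congrFun (congrFun hc k) l
    rw [single_eq_single_vecMulVec_single, mul_vecMulVec, vecMulVec_mul] at this
    simpa [vecMulVec_apply] using this
  have hc0 : c ≠ 0 := by
    rintro rfl
    have := hent a b
    simp [hab] at this
  refine ⟨fun k => -(2 * X.val k b) / c, fun l => X.val a l, ?_⟩
  ext k l
  rw [vecMulVec_apply]
  field_simp
  linear_combination -hent k l

/-- If a sum of two matrices of rank one has rank at most one, then the columns or the rows are
proportional. -/
theorem parallel_of_vecMulVec_add {y₁ y₂ h₁ h₂ y h : Fin n → ℂ} (hy : y₁ ≠ 0) (hh : h₁ ≠ 0)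
    (e : vecMulVec y₁ h₁ + vecMulVec y₂ h₂ = vecMulVec y h) :
    (∃ c : ℂ, y₂ = c • y₁) ∨ ∃ c : ℂ, h₂ = c • h₁ := by
  have hent : ∀ a b, y₁ a * h₁ b + y₂ a * h₂ b = y a * h b := fun a b => by
    simpa [vecMulVec_apply] using congrFun (congrFun e a) b
  -- By Cauchy–Binet a `2 × 2` minor of the sum factors into a minor of the columns and a minor of
  -- the rows; it vanishes because the right side has rank at most one.
  have hminor : ∀ a b c d, (y₁ a * y₂ c - y₁ c * y₂ a) * (h₁ b * h₂ d - h₁ d * h₂ b) = 0 := by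
    intro a b c d
    linear_combination (y₁ c * h₁ d + y₂ c * h₂ d) * hent a b - (y₁ c * h₁ b + y₂ c * h₂ b) *
      hent a d + y a * h b * hent c d - y a * h d * hent c b
  obtain ⟨a, ha⟩ := Function.ne_iff.mp hy
  obtain ⟨b, hb⟩ := Function.ne_iff.mp hh
  simp only [Pi.zero_apply] at ha hb
  by_cases hall : ∀ c, y₁ a * y₂ c - y₁ c * y₂ a = 0
  · left
    refine ⟨y₂ a / y₁ a, funext fun c => ?_⟩
    simp only [Pi.smul_apply, smul_eq_mul]
    field_simp
    linear_combination hall c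
  · right
    push Not at hall
    obtain ⟨c, hc⟩ := hall
    refine ⟨h₂ b / h₁ b, funext fun d => ?_⟩
    have := (mul_eq_zero.mp (hminor a b c d)).resolve_left hc
    simp only [Pi.smul_apply, smul_eq_mul]
    field_simp
    linear_combination this

/-- If `y j` is not proportional to `y i`, then `h j` is proportional to `h i`, and no `y k` can be
proportional to `y i` while `y j` is proportional to `y k`. So each `h k` is linked to `h i`,
directly or through the nonzero `h j`. -/
theorem common_factor {ι : Type*} {y h : ι → Fin n → ℂ} (hh : ∀ i, h i ≠ 0)
    (hpair : ∀ i j, (∃ c : ℂ, y j = c • y i) ∨ ∃ c : ℂ, h j = c • h i) :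
    (∃ y₀, ∀ j, ∃ c : ℂ, y j = c • y₀) ∨ ∃ h₀, ∀ j, ∃ c : ℂ, h j = c • h₀ := by
  rcases isEmpty_or_nonempty ι with hι | ⟨⟨i⟩⟩
  · exact Or.inl ⟨0, fun j => isEmptyElim j⟩
  by_cases hall : ∀ j, ∃ c : ℂ, y j = c • y i
  · exact Or.inl ⟨y i, hall⟩
  push Not at hall
  obtain ⟨j, hj⟩ := hall
  right
  refine ⟨h i, fun k => ?_⟩
  rcases hpair i k with ⟨c, hc⟩ | hk
  · rcases hpair k j with ⟨d, hd⟩ | ⟨d, hd⟩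
    · exact absurd (hd.trans (by rw [hc, smul_smul])) (hj _)
    · obtain ⟨e, he⟩ := (hpair i j).resolve_left fun ⟨c, hc⟩ => hj c hc
      have hd0 : d ≠ 0 := by rintro rfl; exact hh j (by simp [hd])
      refine ⟨d⁻¹ * e, ?_⟩
      rw [mul_smul, ← he, hd, smul_smul, inv_mul_cancel₀ hd0, one_smul]
  · exact hk

theorem slE_val_eq_vecMulVec (i j : Fin n) (h : i ≠ j) :
    (slE i j h).val = vecMulVec (Pi.single i 1) (Pi.single j 1) := by
  rw [slE_val, single_eq_single_vecMulVec_single]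

theorem slE_ne_zero (i j : Fin n) (h : i ≠ j) : slE i j h ≠ 0 := by
  intro h0
  have := congrFun (congrFun (congrArg Subtype.val h0) i) j
  rw [slE_val] at this
  change single i j (1 : ℂ) i j = 0 at this
  simp at this

/-- `[E_{jo}, E_{oj}] = E_{jj} - E_{oo}`, and trace zero removes the total coefficient of `E_{oo}`.
Thus diagonal elements are expressed through units involving the index `o`. -/
theorem diag_eq_sum_lie (o : Fin n) {D : SL n} (hD : D.val.IsDiag) :
    D = ∑ j : {j // j ≠ o}, D.val j j • ⁅slE j o j.2, slE o j j.2.symm⁆ := by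
  have htr : ∑ j, D.val j j = 0 := D.property
  apply Subtype.ext
  change D.val = slVal (∑ j : {j // j ≠ o}, D.val j j • ⁅slE j o j.2, slE o j j.2.symm⁆)
  have hterm : ∀ j : {j // j ≠ o}, slVal (D.val j j • ⁅slE j o j.2, slE o j j.2.symm⁆)
      = D.val j j • (single (j : Fin n) (j : Fin n) (1 : ℂ) - single o o 1) := by
    intro j
    rw [map_smul]
    change D.val j j • (single (j : Fin n) o (1 : ℂ) * single o (j : Fin n) 1
      - single o (j : Fin n) 1 * single (j : Fin n) o 1) = _
    simp
  have hall : ∑ j, D.val j j • (single j j (1 : ℂ) - single o o 1) = D.val := by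
    simp only [smul_sub, Finset.sum_sub_distrib, ← Finset.sum_smul, htr, zero_smul, sub_zero]
    ext a b
    rw [Matrix.sum_apply]
    by_cases hab : a = b
    · subst hab
      simp [Matrix.single_apply]
    · rw [hD hab]
      refine Finset.sum_eq_zero fun j _ => ?_
      have : ¬ (j = a ∧ j = b) := fun h => hab (h.1.symm.trans h.2)
      simp [this]
  have herase : ∑ j ∈ Finset.univ.erase o, D.val j j • (single j j (1 : ℂ) - single o o 1)
      = ∑ j, D.val j j • (single j j (1 : ℂ) - single o o 1) :=
    Finset.sum_erase _ (by rw [sub_self, smul_zero])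
  rw [map_sum, Finset.sum_congr rfl fun j _ => hterm j]
  refine hall.symm.trans (herase.symm.trans ?_)
  exact Finset.sum_subtype _ (by simp) _

end Extremal

/-! ### Recovering the conjugating matrix of an automorphism. -/

section Classification

open Matrix

variable {n : ℕ}

theorem lie_slE_slE {i j k : Fin n} (hij : i ≠ j) (hjk : j ≠ k) (hik : i ≠ k) :
    ⁅slE i j hij, slE j k hjk⁆ = slE i k hik := by
  apply Subtype.ext
  change single i j (1 : ℂ) * single j k 1 - single j k 1 * single i j 1 = single i k 1
  simp [hik.symm]

/-- The vector `y` plays the role of the image of the basis vector `e_o`, and `g(E_{jo}) y` that of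
`e_j`. With these as columns of `A` one gets `g(X) A = A X`. The matrix products needed are first
recovered from brackets, which `g` preserves. -/
theorem exists_conj_of_common_column [Nontrivial (Fin n)] (g : SL n ≃ₗ⁅ℂ⁆ SL n) (o : Fin n)
    (y : Fin n → ℂ) (hg : ∀ j (hj : o ≠ j), ∃ h, (g (slE o j hj)).val = vecMulVec y h) :
    ∃ A : SpecialLinearGroup (Fin n) ℂ, ∀ X, g X = conjSL A X := by
  have hn : n ≠ 0 := by rintro rfl; exact isEmptyElim o
  obtain ⟨k₀, hk₀⟩ := exists_ne o
  have gne : ∀ i j (h : i ≠ j), (g (slE i j h)).val ≠ 0 := by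
    intro i j h h0
    exact slE_ne_zero i j h (g.injective ((Subtype.ext h0).trans (map_zero g).symm))
  have hval : ∀ X Y : SL n, (g ⁅X, Y⁆).val = (g X).val * (g Y).val - (g Y).val * (g X).val := by
    intro X Y; rw [LieEquiv.map_lie, sl_bracket_val]
  have hy0 : y ≠ 0 := by
    rintro rfl
    obtain ⟨h, hh⟩ := hg k₀ hk₀.symm
    exact gne _ _ _ (hh.trans (zero_vecMulVec h))
  have hext : ∀ (i j : Fin n) (h : i ≠ j), IsExtremal (slE i j h) := fun i j h =>
    isExtremal_of_eq_vecMulVec (slE_val_eq_vecMulVec i j h)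
  have hsq : ∀ (i j : Fin n) (h : i ≠ j), (g (slE i j h)).val * (g (slE i j h)).val = 0 := fun i j h =>
    ((hext i j h).map g).mul_self_eq_zero hn
  -- the images of `E_{oj}` annihilate `y`
  have hEy : ∀ j (hj : o ≠ j), (g (slE o j hj)).val *ᵥ y = 0 := by
    intro j hj
    obtain ⟨h, hh⟩ := hg j hj
    have h1 := hsq o j hj
    rw [hh, vecMulVec_mul_vecMulVec, vecMulVec_eq_zero] at h1
    rw [hh, vecMulVec_mulVec]
    rcases h1 with h1 | h1
    · exact absurd h1 hy0
    · rcases smul_eq_zero.mp h1 with h1 | h1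
      · simp [h1]
      · simp [h1]
  have hEv : ∀ j (hj : o ≠ j), ∃ v, (g (slE o j hj)).val *ᵥ v = y := by
    intro j hj
    obtain ⟨h, hh⟩ := hg j hj
    have h0 : h ≠ 0 := by
      rintro rfl
      exact gne o j hj (hh.trans (vecMulVec_zero y))
    obtain ⟨b, hb⟩ := Function.ne_iff.mp h0
    simp only [Pi.zero_apply] at hb
    refine ⟨Pi.single b (h b)⁻¹, ?_⟩
    rw [hh, vecMulVec_mulVec]
    simp [hb]
  -- Because `E_{oj}` and its image have square zero, `[E, [E, F]] = -2 E F E` turns a double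
  -- bracket into an associative product.
  have hEFE : ∀ i j (hi : i ≠ o) (hj : o ≠ j), (g (slE o j hj)).val * (g (slE i o hi)).val *
      (g (slE o j hj)).val = if i = j then (g (slE o j hj)).val else 0 := by
    intro i j hi hj
    have h1 : ⁅slE o j hj, ⁅slE o j hj, slE i o hi⁆⁆
        = (if i = j then (-2 : ℂ) else 0) • slE o j hj := by
      apply Subtype.ext
      rw [lie_lie_val]
      change _ = (if i = j then (-2 : ℂ) else 0) • single o j (1 : ℂ)
      by_cases hij : i = j
      · subst hij
        simp [hi]
      · simp [hij, hj.symm, Ne.symm hij]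
    have h2 := congrArg (fun X => (g X).val) h1
    simp only [LieEquiv.map_lie, map_smul] at h2
    rw [lie_lie_val, hsq, zero_mul, mul_zero, zero_sub, add_zero] at h2
    change _ = (if i = j then (-2 : ℂ) else 0) • (g (slE o j hj)).val at h2
    have h3 : (2 : ℂ) ≠ 0 := two_ne_zero
    split_ifs at h2 ⊢ with hij
    · rw [neg_smul, neg_inj] at h2
      exact smul_right_injective _ h3 h2
    · rw [zero_smul, neg_eq_zero] at h2
      exact (smul_eq_zero.mp h2).resolve_left h3
  have hEFy : ∀ i j (hi : i ≠ o) (hj : o ≠ j), (g (slE o j hj)).val *ᵥ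
      ((g (slE i o hi)).val *ᵥ y) = if i = j then y else 0 := by
    intro i j hi hj
    obtain ⟨v, hv⟩ := hEv j hj
    have h1 := congrArg (fun M => M *ᵥ v) (hEFE i j hi hj)
    simp only [← mulVec_mulVec, hv] at h1
    rw [h1]
    split_ifs
    · exact hv
    · simp
  -- The two images commute, and the square of their sum vanishes because `E_{io} + E_{jo}` is
  -- extremal; hence twice their product is zero.
  have hFF : ∀ i j (hi : i ≠ o) (hj : j ≠ o), (g (slE i o hi)).val * (g (slE j o hj)).val = 0 := by
    intro i j hi hj
    have hsum : IsExtremal (slE i o hi + slE j o hj) :=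
      isExtremal_of_eq_vecMulVec (x := Pi.single i 1 + Pi.single j 1) (f := Pi.single o 1) (by
        rw [add_vecMulVec, ← slE_val_eq_vecMulVec i o hi, ← slE_val_eq_vecMulVec j o hj]
        rfl)
    have h1 := (hsum.map g).mul_self_eq_zero hn
    rw [map_add] at h1
    change ((g (slE i o hi)).val + (g (slE j o hj)).val)
      * ((g (slE i o hi)).val + (g (slE j o hj)).val) = 0 at h1
    have h2 : ⁅slE i o hi, slE j o hj⁆ = 0 := by
      apply Subtype.ext
      change single i o (1 : ℂ) * single j o 1 - single j o 1 * single i o 1 = 0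
      simp [hi.symm, hj.symm]
    have h3 := hval (slE i o hi) (slE j o hj)
    rw [h2, map_zero] at h3
    have h4 : (g (slE i o hi)).val * (g (slE j o hj)).val
        = (g (slE j o hj)).val * (g (slE i o hi)).val := (sub_eq_zero.mp h3.symm)
    rw [add_mul, mul_add, mul_add, hsq, hsq, zero_add, add_zero, ← h4, ← two_smul ℂ] at h1
    exact (smul_eq_zero.mp h1).resolve_left two_ne_zero
  let col : Fin n → Fin n → ℂ := fun j => if h : j = o then y else (g (slE j o h)).val *ᵥ y
  have hcolo : col o = y := by simp [col]
  have hcol : ∀ j (hj : j ≠ o), col j = (g (slE j o hj)).val *ᵥ y := fun j hj => by simp [col, hj]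
  have hadd : ∀ X Y : SL n, (g (X + Y)).val = (g X).val + (g Y).val := fun X Y => by
    rw [map_add]; rfl
  have hsmul : ∀ (c : ℂ) (X : SL n), (g (c • X)).val = c • (g X).val := fun c X => by
    rw [map_smul]; rfl
  have step : ∀ X : SL n, (g X).val *ᵥ y = ∑ i, X.val i o • col i := by
    intro X
    induction X using sl_induction with
    | hadd X Y hX hY =>
      rw [hadd, add_mulVec, hX, hY, ← Finset.sum_add_distrib]
      refine Finset.sum_congr rfl fun i _ => ?_
      rw [← add_smul]; rfl
    | hsingle i j h c =>
      have hs : ∑ a, (c • slE i j h).val a o • col a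
          = c • ∑ a, (slE i j h).val a o • col a := by
        rw [Finset.smul_sum]
        refine Finset.sum_congr rfl fun a _ => ?_
        rw [smul_smul]; rfl
      rw [hsmul, smul_mulVec, hs]
      congr 1
      by_cases hj : j = o
      · subst hj
        rw [Finset.sum_eq_single i]
        · simp [hcol i h]
        · intro b _ hb
          simp [Ne.symm hb]
        · simp
      · have : ∑ a, (slE i j h).val a o • col a = 0 :=
          Finset.sum_eq_zero fun a _ => by simp [hj]
        rw [this]
        by_cases hi : i = o
        · subst hi
          exact hEy j h
        · rw [← lie_slE_slE hi (Ne.symm hj) h, hval, sub_mulVec, ← mulVec_mulVec, ← mulVec_mulVec,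
            hEy, hEFy, if_neg h, mulVec_zero, sub_zero]
    | hdiag D hD =>
      have hr : ∑ a, D.val a o • col a = D.val o o • y := by
        rw [Finset.sum_eq_single o, hcolo]
        · intro b _ hb
          rw [hD hb, zero_smul]
        · simp
      rw [hr]
      have htr : ∑ j, D.val j j = 0 := D.property
      rw [← Finset.add_sum_erase _ _ (Finset.mem_univ o),
        Finset.sum_subtype (p := fun j => j ≠ o) _ (by simp)] at htr
      have hL : (g D).val *ᵥ y = ∑ j : {j // j ≠ o}, -(D.val j j • y) := by
        have hlin : ∀ s : Finset {j // j ≠ o}, (g (∑ j ∈ s, D.val j j •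
            ⁅slE j.1 o j.2, slE o j.1 j.2.symm⁆)).val *ᵥ y = ∑ j ∈ s, -(D.val j j • y) := by
          classical
          intro s
          induction s using Finset.induction_on with
          | empty =>
            rw [Finset.sum_empty, map_zero]
            exact zero_mulVec y
          | insert j s hjs ih =>
            rw [Finset.sum_insert hjs, Finset.sum_insert hjs, hadd, add_mulVec, ih, hsmul, hval,
              smul_mulVec, sub_mulVec, ← mulVec_mulVec, ← mulVec_mulVec, hEy, hEFy, if_pos rfl,
              mulVec_zero, zero_sub, smul_neg]
        have := hlin Finset.univ
        rwa [← diag_eq_sum_lie o hD] at this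
      rw [hL, Finset.sum_neg_distrib, ← Finset.sum_smul, ← neg_smul]
      congr 1
      linear_combination -htr
  have hFcol : ∀ j (hj : j ≠ o) (v : Fin n → ℂ),
      (g (slE j o hj)).val *ᵥ (∑ i, v i • col i) = v o • col j := by
    intro j hj v
    rw [mulVec_sum, Finset.sum_eq_single o]
    · rw [mulVec_smul, hcolo, ← hcol j hj]
    · intro i _ hi
      rw [mulVec_smul, hcol i hi, mulVec_mulVec, hFF, zero_mulVec, smul_zero]
    · simp
  have hact : ∀ (X : SL n) (j : Fin n), (g X).val *ᵥ col j = ∑ i, X.val i j • col i := by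
    intro X j
    by_cases hj : j = o
    · subst hj
      rw [hcolo]
      exact step X
    · have h1 := hval X (slE j o hj)
      -- Moving `g X` past `g(E_{jo})` reduces column `j` to column `o`, where `step` applies to
      -- `[X, E_{jo}]` and to `X`.
      have h2 : (g X).val * (g (slE j o hj)).val
          = (g ⁅X, slE j o hj⁆).val + (g (slE j o hj)).val * (g X).val := by rw [h1]; abel
      rw [hcol j hj, mulVec_mulVec, h2, add_mulVec, ← mulVec_mulVec, step, step, hFcol]
      have h3 : ∀ i, (⁅X, slE j o hj⁆ : SL n).val i o
          = X.val i j - if i = j then X.val o o else 0 := by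
        intro i
        rw [sl_bracket_val]
        by_cases hij : i = j
        · subst hij; simp
        · simp [hij]
      simp only [h3, sub_smul, Finset.sum_sub_distrib, ite_smul, zero_smul, Finset.sum_ite_eq',
        Finset.mem_univ, if_true, sub_add_cancel]
  let A : Matrix (Fin n) (Fin n) ℂ := Matrix.of fun a j => col j a
  have hA : ∀ X : SL n, (g X).val * A = A * X.val := by
    intro X
    ext a j
    have h1 := congrFun (hact X j) a
    rw [Finset.sum_apply] at h1
    rw [mul_apply, mul_apply]
    refine h1.trans (Finset.sum_congr rfl fun i _ => ?_)
    exact mul_comm _ _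
  have hAcol : ∀ j, A *ᵥ Pi.single j 1 = col j := by
    intro j
    ext a
    simp [A]
  -- Apply `g(E_{ij}) A = A E_{ij}` to a kernel vector `v`: as `E_{ij} v = v_j e_i`, column `i` of
  -- `A` vanishes. A nonzero kernel therefore forces `y = 0`, in one or two applications.
  have hsE : ∀ (i j : Fin n) (h : i ≠ j) (v : Fin n → ℂ), A *ᵥ v = 0 → v j ≠ 0 → col i = 0 := by
    intro i j h v hv hvj
    have h1 := congrArg (fun M => M *ᵥ v) (hA (slE i j h))
    simp only [← mulVec_mulVec, hv, mulVec_zero] at h1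
    rw [slE_val_eq_vecMulVec, vecMulVec_mulVec, single_one_dotProduct] at h1
    rw [show MulOpposite.op (v j) • (Pi.single i 1 : Fin n → ℂ) = v j • Pi.single i 1 by
      ext; simp [mul_comm], mulVec_smul, hAcol] at h1
    exact (smul_eq_zero.mp h1.symm).resolve_left hvj
  have hdet : A.det ≠ 0 := by
    intro h0
    obtain ⟨v, hv0, hv⟩ := exists_mulVec_eq_zero_iff.mpr h0
    obtain ⟨k, hk⟩ := Function.ne_iff.mp hv0
    obtain ⟨i, hik⟩ := exists_ne k
    have hi := hsE i k hik v hv hk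
    by_cases hio : i = o
    · rw [hio, hcolo] at hi
      exact hy0 hi
    · have := hsE o i (Ne.symm hio) (Pi.single i 1) ((hAcol i).trans hi) (by simp)
      rw [hcolo] at this
      exact hy0 this
  -- Dividing `A` by an `n`-th root of its determinant gives determinant one without changing the
  -- conjugation.
  obtain ⟨c, hc⟩ := IsAlgClosed.exists_pow_nat_eq A.det (Nat.pos_of_ne_zero hn)
  have hc0 : c ≠ 0 := by
    rintro rfl
    rw [zero_pow hn] at hc
    exact hdet hc.symm
  let B : SpecialLinearGroup (Fin n) ℂ := ⟨c⁻¹ • A, by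
    rw [det_smul, Fintype.card_fin, ← hc, inv_pow, inv_mul_cancel₀ (pow_ne_zero n hc0)]⟩
  refine ⟨B, fun X => Subtype.ext ?_⟩
  change (g X).val = B.val * X.val * (B⁻¹).val
  have hB : B.val * X.val = (g X).val * B.val := by
    change (c⁻¹ • A) * X.val = (g X).val * (c⁻¹ • A)
    rw [smul_mul_assoc, ← hA, mul_smul_comm]
  have hBB : B.val * (B⁻¹).val = 1 := congrArg Subtype.val (mul_inv_cancel B)
  rw [hB, mul_assoc, hBB, mul_one]

theorem outI_conjSL (A : SpecialLinearGroup (Fin n) ℂ) (X : SL n) :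
    outI n (conjSL A X) = conjSL A⁻¹.transpose (outI n X) := by
  apply Subtype.ext
  change -(A.val * X.val * (A⁻¹).val).transpose
    = (A⁻¹).val.transpose * (-X.val.transpose) * ((A⁻¹).transpose⁻¹).val
  have h : (A⁻¹).transpose⁻¹ = A.transpose := by
    rw [inv_eq_iff_mul_eq_one]
    apply Subtype.ext
    change (A⁻¹).val.transpose * A.val.transpose = 1
    have hAA : A.val * (A⁻¹).val = 1 := congrArg Subtype.val (mul_inv_cancel A)
    rw [← transpose_mul, hAA, transpose_one]
  rw [h, transpose_mul, transpose_mul]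
  change _ = (A⁻¹).val.transpose * (-X.val.transpose) * A.val.transpose
  noncomm_ring

/-- Every automorphism of `sl(n, ℂ)` is conjugation, possibly preceded by `X ↦ -Xᵀ`. -/
theorem automorphism_classification (g : SL n ≃ₗ⁅ℂ⁆ SL n) :
    (∃ A : SpecialLinearGroup (Fin n) ℂ, ∀ X, g X = conjSL A X) ∨
      ∃ A : SpecialLinearGroup (Fin n) ℂ, ∀ X, g X = conjSL A (outI n X) := by
  rcases subsingleton_or_nontrivial (Fin n) with h | h
  · have := subsingleton_SL (n := n)
    exact Or.inl ⟨1, fun X => Subsingleton.elim _ _⟩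
  obtain ⟨o, -⟩ := exists_pair_ne (Fin n)
  have hn : n ≠ 0 := by rintro rfl; exact isEmptyElim o
  have hexist : ∀ j : {j // o ≠ j}, ∃ y h, (g (slE o j j.2)).val = vecMulVec y h := fun j =>
    ((isExtremal_of_eq_vecMulVec (slE_val_eq_vecMulVec o j.1 j.2)).map g).exists_eq_vecMulVec hn
  choose y h hyh using hexist
  have hne : ∀ j : {j // o ≠ j}, vecMulVec (y j) (h j) ≠ 0 := by
    intro j h0
    rw [← hyh j] at h0
    exact slE_ne_zero o j.1 j.2 (g.injective ((Subtype.ext h0).trans (map_zero g).symm))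
  have hy : ∀ j, y j ≠ 0 := fun j h0 => hne j (by rw [h0, zero_vecMulVec])
  have hh : ∀ j, h j ≠ 0 := fun j h0 => hne j (by rw [h0, vecMulVec_zero])
  -- `E_{oi} + E_{oj}` is again a column times a row with trace zero, so the sum of the two images
  -- also has rank at most one.
  have hpair : ∀ i j, (∃ c : ℂ, y j = c • y i) ∨ ∃ c : ℂ, h j = c • h i := by
    intro i j
    have hsum : IsExtremal (slE o i.1 i.2 + slE o j.1 j.2) :=
      isExtremal_of_eq_vecMulVec (x := Pi.single o 1) (f := Pi.single i.1 1 + Pi.single j.1 1) (by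
        rw [vecMulVec_add, ← slE_val_eq_vecMulVec o i.1 i.2, ← slE_val_eq_vecMulVec o j.1 j.2]
        rfl)
    obtain ⟨y', h', e⟩ := (hsum.map g).exists_eq_vecMulVec hn
    rw [map_add] at e
    change (g (slE o i.1 i.2)).val + (g (slE o j.1 j.2)).val = _ at e
    rw [hyh i, hyh j] at e
    exact parallel_of_vecMulVec_add (hy i) (hh i) e
  rcases common_factor hh hpair with ⟨y₀, h₀⟩ | ⟨h₀, hc⟩
  · left
    refine exists_conj_of_common_column g o y₀ fun j hj => ?_
    obtain ⟨c, hc⟩ := h₀ ⟨j, hj⟩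
    exact ⟨c • h ⟨j, hj⟩, by rw [hyh ⟨j, hj⟩, hc, smul_vecMulVec, vecMulVec_smul]⟩
  · right
    -- Transposition turns the common row into a common column.
    obtain ⟨A, hA⟩ := exists_conj_of_common_column (g.trans (outI n)) o h₀ fun j hj => by
      obtain ⟨c, hc⟩ := hc ⟨j, hj⟩
      refine ⟨-(c • y ⟨j, hj⟩), ?_⟩
      change -(g (slE o j hj)).val.transpose = _
      rw [hyh ⟨j, hj⟩, hc, transpose_vecMulVec, smul_vecMulVec, vecMulVec_neg, vecMulVec_smul]
    refine ⟨A⁻¹.transpose, fun X => ?_⟩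
    have := hA X
    change outI n (g X) = conjSL A X at this
    rw [← outI_conjSL, ← this, outI_outI]

/-- The twist of an irreducible representation by an outer automorphism is its contragredient. -/
theorem intertwined_outer_dual {V : Type*} [AddCommGroup V] [Module ℂ V] [FiniteDimensional ℂ V]
    {ρ : SL n →ₗ[ℂ] Module.End ℂ V} (hρ : IsLieRep ρ) (iρ : IsIrred ρ)
    {g : SL n ≃ₗ⁅ℂ⁆ SL n} (hg : IsOuter g) :
    Intertwined (ρ ∘ₗ (g.toLinearEquiv : SL n →ₗ[ℂ] SL n)) (dualRep ρ) := by
  rcases automorphism_classification g with ⟨A, hA⟩ | ⟨A, hA⟩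
  · exact absurd ⟨A, fun X => congrArg Subtype.val (hA X)⟩ hg
  · exact (intertwined_of_conj hρ A hA).trans (intertwined_outI_dual hρ iρ)

end Classification

/-! ### The intertwiner `J` -/

section GelfandTseitlin

variable {n : ℕ}

theorem TopRow.contra_row_one (m : TopRow n) : m.contra.row 1 = m.row 1 := by
  simp only [TopRow.contra]
  split_ifs with h
  · rw [show n + 1 - 1 = n by omega, m.row_last, sub_zero]
  · rw [m.row_eq_zero 1 h]

theorem TopRow.contra_contra (m : TopRow n) : m.contra.contra = m := by
  ext i
  change (if 1 ≤ i ∧ i ≤ n then m.contra.row 1 - m.contra.row (n + 1 - i) else 0) = m.row i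
  split_ifs with h
  · rw [m.contra_row_one]
    simp only [TopRow.contra]
    rw [if_pos (by omega), show n + 1 - (n + 1 - i) = i by omega]
    ring
  · exact (m.row_eq_zero i h).symm

theorem dualEntries_dualEntries (m : TopRow n) {e : ℕ → ℕ → ℤ}
    (he : ∀ i j, ¬ (1 ≤ i ∧ i ≤ j ∧ j ≤ n) → e i j = 0) :
    dualEntries m.contra (dualEntries m e) = e := by
  ext i j
  simp only [dualEntries]
  split_ifs with h h'
  · rw [m.contra_row_one, show j + 1 - (j + 1 - i) = i by omega]
    ring
  · omega
  · exact (he i j h).symm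

theorem isPattern_dualEntries_iff (m : TopRow n) {e : ℕ → ℕ → ℤ}
    (he : ∀ i j, ¬ (1 ≤ i ∧ i ≤ j ∧ j ≤ n) → e i j = 0) :
    IsPattern m.contra (dualEntries m e) ↔ IsPattern m e := by
  refine ⟨fun h => ?_, isPattern_dualEntries⟩
  have := isPattern_dualEntries h
  rwa [dualEntries_dualEntries m he, m.contra_contra] at this

theorem dualEntries_shift (m : TopRow n) (e : ℕ → ℕ → ℤ) {j k : ℕ} (hj : 1 ≤ j) (hjk : j ≤ k)
    (hk : k ≤ n) (d : ℤ) :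
    dualEntries m (shift e j k d) = shift (dualEntries m e) (k + 1 - j) k (-d) := by
  ext a b
  simp only [dualEntries, shift]
  by_cases hb : b = k
  · subst hb
    by_cases ha : a = b + 1 - j
    · subst ha
      rw [if_pos (by omega), if_pos (by omega), if_pos (by omega), if_pos (by omega)]
      ring
    · by_cases h : 1 ≤ a ∧ a ≤ b ∧ b ≤ n
      · rw [if_pos h, if_neg (by omega), if_neg (by omega), if_pos h]
      · rw [if_neg h, if_neg (by omega), if_neg h]
  · simp [hb]

theorem shift_eq_zero {m : TopRow n} {e : ℕ → ℕ → ℤ} (he : IsPattern m e) {j k : ℕ}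
    (hj : 1 ≤ j) (hjk : j ≤ k) (hk : k ≤ n) (d : ℤ) :
    ∀ a b, ¬ (1 ≤ a ∧ a ≤ b ∧ b ≤ n) → shift e j k d a b = 0 := by
  intro a b h
  simp only [shift]
  rw [if_neg (by rintro ⟨rfl, rfl⟩; exact h ⟨hj, hjk, hk⟩), he.eq_zero a b h]

theorem entrySum_shift (e : ℕ → ℕ → ℤ) {j k : ℕ} (hj : 1 ≤ j) (hjk : j ≤ k) (hk : k ≤ n)
    (d : ℤ) : entrySum n (shift e j k d) = entrySum n e + d := by
  have hrow : ∀ l, rowSum (shift e j k d) l = rowSum e l + if l = k then d else 0 := by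
    intro l
    by_cases hl : l = k
    · subst hl
      have : ∀ i ∈ Finset.Icc 1 l, shift e j l d i l = e i l + if i = j then d else 0 := by
        intro i _
        simp only [shift]
        split_ifs <;> simp_all
      rw [rowSum, Finset.sum_congr rfl this, Finset.sum_add_distrib, Finset.sum_ite_eq',
        if_pos (Finset.mem_Icc.mpr ⟨hj, hjk⟩), if_pos rfl, rowSum]
    · rw [if_neg hl, add_zero, rowSum, rowSum]
      exact Finset.sum_congr rfl fun i _ => by simp [shift, hl]
  rw [entrySum, Finset.sum_congr rfl fun l _ => hrow l, Finset.sum_add_distrib,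
    Finset.sum_ite_eq', if_pos (Finset.mem_Icc.mpr ⟨by omega, hk⟩), entrySum]

theorem sum_Icc_flip {M : Type*} [AddCommMonoid M] (k : ℕ) (f : ℕ → M) :
    ∑ j ∈ Finset.Icc 1 k, f (k + 1 - j) = ∑ j ∈ Finset.Icc 1 k, f j := by
  refine Finset.sum_nbij' (fun j => k + 1 - j) (fun j => k + 1 - j) ?_ ?_ ?_ ?_ ?_ <;>
    simp only [Finset.mem_Icc] <;> intros
  all_goals first | omega | trivial

theorem rowSum_dualEntries (m : TopRow n) (e : ℕ → ℕ → ℤ) {k : ℕ} (hk : k ≤ n) :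
    rowSum (dualEntries m e) k = k * m.row 1 - rowSum e k := by
  have : ∀ i ∈ Finset.Icc 1 k, dualEntries m e i k = m.row 1 - e (k + 1 - i) k := by
    intro i hi
    rw [Finset.mem_Icc] at hi
    simp only [dualEntries]
    rw [if_pos ⟨hi.1, hi.2, hk⟩]
  rw [rowSum, Finset.sum_congr rfl this, Finset.sum_sub_distrib,
    sum_Icc_flip k fun i => e i k, rowSum]
  simp

theorem sum_Icc_id (n : ℕ) : ∑ k ∈ Finset.Icc 1 n, (k : ℤ) = ((n * (n + 1) / 2 : ℕ) : ℤ) := by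
  have h2 : (∑ k ∈ Finset.Icc 1 n, k) * 2 = n * (n + 1) := by
    induction n with
    | zero => rfl
    | succ n ih => rw [Finset.sum_Icc_succ_top (by omega), add_mul, ih]; ring
  rw [← h2, Nat.mul_div_cancel _ two_pos]
  push_cast
  rfl

theorem entrySum_dualEntries (m : TopRow n) (e : ℕ → ℕ → ℤ) :
    entrySum n (dualEntries m e) = m.row 1 * ((n * (n + 1) / 2 : ℕ) : ℤ) - entrySum n e := by
  rw [entrySum, Finset.sum_congr rfl fun k hk =>
    rowSum_dualEntries m e (Finset.mem_Icc.mp hk).2, Finset.sum_sub_distrib, ← Finset.sum_mul,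
    sum_Icc_id, entrySum, mul_comm]

/-! Coefficients -/

theorem prod_Icc_flip {M : Type*} [CommMonoid M] (k : ℕ) (f : ℕ → M) :
    ∏ j ∈ Finset.Icc 1 k, f (k + 1 - j) = ∏ j ∈ Finset.Icc 1 k, f j := by
  refine Finset.prod_nbij' (fun j => k + 1 - j) (fun j => k + 1 - j) ?_ ?_ ?_ ?_ ?_ <;>
    simp only [Finset.mem_Icc] <;> intros
  all_goals first | omega | trivial

theorem prod_Icc_erase_flip {M : Type*} [CommMonoid M] {j k : ℕ} (hjk : j ≤ k)
    (f : ℕ → M) : ∏ i ∈ (Finset.Icc 1 k).erase (k + 1 - j), f (k + 1 - i)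
      = ∏ i ∈ (Finset.Icc 1 k).erase j, f i := by
  refine Finset.prod_nbij' (fun j => k + 1 - j) (fun j => k + 1 - j) ?_ ?_ ?_ ?_ ?_ <;>
    simp only [Finset.mem_Icc, Finset.mem_erase] <;> intros
  all_goals first | omega | trivial

/-- Reversing rows changes the sign of every factor. The numerator has `(k + 1) + (k - 1) = 2k`
factors and the denominator comes in pairs, so the signs cancel. Rows `k - 1`, `k`, `k + 1` are
reversed about different centres, which accounts for the offsets by one between `a` and `b`. -/
theorem raiseCoeff_dualEntries (m : TopRow n) (e : ℕ → ℕ → ℤ) {j k : ℕ} (hj : 1 ≤ j)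
    (hjk : j ≤ k) (hk : k + 1 ≤ n) :
    raiseCoeff (dualEntries m e) k (k + 1 - j) = lowerCoeff e k j := by
  have hd : ∀ i l, 1 ≤ i → i ≤ l → l ≤ n → dualEntries m e i l = m.row 1 - e (l + 1 - i) l := by
    intro i l h1 h2 h3
    simp only [dualEntries]
    rw [if_pos ⟨h1, h2, h3⟩]
  have hdj : dualEntries m e (k + 1 - j) k = m.row 1 - e j k := by
    rw [hd _ _ (by omega) (by omega) (by omega), show k + 1 - (k + 1 - j) = j by omega]
  have p1 : ∏ i ∈ Finset.Icc 1 (k + 1),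
      ((dualEntries m e i (k + 1) - dualEntries m e (k + 1 - j) k - i + (k + 1 - j : ℕ) : ℤ) : ℝ)
      = (-1) ^ (k + 1) *
        ∏ i ∈ Finset.Icc 1 (k + 1), ((e i (k + 1) - e j k - i + j + 1 : ℤ) : ℝ) := by
    rw [← prod_Icc_flip (k + 1) fun i => ((e i (k + 1) - e j k - i + j + 1 : ℤ) : ℝ)]
    have hc : (-1 : ℝ) ^ (k + 1) = ∏ i ∈ Finset.Icc 1 (k + 1), (-1 : ℝ) := by simp
    rw [hc, ← Finset.prod_mul_distrib]
    refine Finset.prod_congr rfl fun i hi => ?_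
    rw [Finset.mem_Icc] at hi
    rw [hdj, hd i (k + 1) hi.1 hi.2 hk, Nat.cast_sub (show j ≤ k + 1 by omega),
      Nat.cast_sub (show i ≤ k + 1 + 1 by omega)]
    push_cast
    ring
  have p2 : ∏ i ∈ Finset.Icc 1 (k - 1),
      ((dualEntries m e i (k - 1) - dualEntries m e (k + 1 - j) k - i + (k + 1 - j : ℕ) - 1 : ℤ)
        : ℝ)
      = (-1) ^ (k - 1) *
        ∏ i ∈ Finset.Icc 1 (k - 1), ((e i (k - 1) - e j k - i + j : ℤ) : ℝ) := by
    rw [← prod_Icc_flip (k - 1) fun i => ((e i (k - 1) - e j k - i + j : ℤ) : ℝ)]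
    have hc : (-1 : ℝ) ^ (k - 1) = ∏ i ∈ Finset.Icc 1 (k - 1), (-1 : ℝ) := by simp
    rw [hc, ← Finset.prod_mul_distrib]
    refine Finset.prod_congr rfl fun i hi => ?_
    rw [Finset.mem_Icc] at hi
    rw [hdj, hd i (k - 1) hi.1 hi.2 (by omega), Nat.cast_sub (show j ≤ k + 1 by omega),
      Nat.cast_sub (show i ≤ k - 1 + 1 by omega), show k - 1 + 1 = k by omega]
    push_cast
    ring
  have p3 : ∏ i ∈ (Finset.Icc 1 k).erase (k + 1 - j),
      (((dualEntries m e i k - dualEntries m e (k + 1 - j) k - i + (k + 1 - j : ℕ) : ℤ) : ℝ) *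
        ((dualEntries m e i k - dualEntries m e (k + 1 - j) k - i + (k + 1 - j : ℕ) - 1 : ℤ) : ℝ))
      = ∏ i ∈ (Finset.Icc 1 k).erase j,
        (((e i k - e j k - i + j + 1 : ℤ) : ℝ) * ((e i k - e j k - i + j : ℤ) : ℝ)) := by
    rw [← prod_Icc_erase_flip hjk fun i =>
      (((e i k - e j k - i + j + 1 : ℤ) : ℝ) * ((e i k - e j k - i + j : ℤ) : ℝ))]
    refine Finset.prod_congr rfl fun i hi => ?_
    rw [Finset.mem_erase, Finset.mem_Icc] at hi
    rw [hdj, hd i k hi.2.1 hi.2.2 (by omega), Nat.cast_sub (show j ≤ k + 1 by omega),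
      Nat.cast_sub (show i ≤ k + 1 by omega)]
    push_cast
    ring
  have hsign : (-1 : ℝ) ^ (k + 1) * (-1) ^ (k - 1) = 1 := by
    rw [← pow_add, show k + 1 + (k - 1) = 2 * k by omega, pow_mul]
    simp
  rw [raiseCoeff, lowerCoeff, p1, p2, p3]
  congr 3
  rw [mul_mul_mul_comm, hsign, one_mul]

theorem lowerCoeff_dualEntries (m : TopRow n) {e : ℕ → ℕ → ℤ} (he : IsPattern m e) {j k : ℕ}
    (hj : 1 ≤ j) (hjk : j ≤ k) (hk : k + 1 ≤ n) :
    lowerCoeff (dualEntries m e) k (k + 1 - j) = raiseCoeff e k j := by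
  have := raiseCoeff_dualEntries m.contra (dualEntries m e) (j := k + 1 - j) (k := k)
    (by omega) (by omega) hk
  rw [dualEntries_dualEntries m he.eq_zero, show k + 1 - (k + 1 - j) = j by omega] at this
  exact this.symm

/-! Action of `J` on the generators -/

theorem onPatterns_single {m : TopRow n} {W : Type*} [AddCommGroup W] [Module ℂ W]
    (f : Pattern m → W) (p : Pattern m) : onPatterns f (Finsupp.single p 1) = f p := by
  simp [onPatterns]

theorem eqOn_of_single {m : TopRow n} {W : Type*} [AddCommGroup W] [Module ℂ W]
    {S T : GTSpace m →ₗ[ℂ] W}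
    (h : ∀ p, S (Finsupp.single p 1) = T (Finsupp.single p 1)) : S = T := by
  ext p
  simpa using h p

theorem xi_val {m : TopRow n} (p : Pattern m) : xi m p.val = Finsupp.single p 1 := by
  rw [xi, dif_pos p.2]

/-- The array need not be a pattern: both sides then vanish, so terms omitted in one action
correspond to terms omitted in the other. The support condition makes the reversal involutive. -/
theorem opJ_xi (m : TopRow n) {e : ℕ → ℕ → ℤ}
    (he : ∀ i j, ¬ (1 ≤ i ∧ i ≤ j ∧ j ≤ n) → e i j = 0) :
    opJ (rfl : m.contra = m.contra) (xi m e)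
      = ((-1 : ℂ) ^ entrySum n e) • xi m.contra (dualEntries m e) := by
  by_cases h : IsPattern m e
  · rw [xi, dif_pos h, xi, dif_pos (isPattern_dualEntries h), opJ, onPatterns_single]
    rfl
  · rw [xi, dif_neg h, xi, dif_neg (mt (isPattern_dualEntries_iff m he).mp h), map_zero, smul_zero]

/-- The calculation common to raising and lowering. Changing one entry by `d = ±1` flips the sign in
`J`, and reversing the row matches the summand `j` with `k + 1 - j`. -/
theorem opJ_sum_shift (m : TopRow n) (p : Pattern m) {k : ℕ} (hk : k + 1 ≤ n) (d : ℤ)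
    (hd : (-1 : ℂ) ^ d = -1) (α β : ℕ → ℝ)
    (hαβ : ∀ j, 1 ≤ j → j ≤ k → β (k + 1 - j) = α j) :
    opJ (rfl : m.contra = m.contra)
        (∑ j ∈ Finset.Icc 1 k, (α j : ℂ) • xi m (shift p.val j k d))
      = -(((-1 : ℂ) ^ entrySum n p.val) • ∑ j ∈ Finset.Icc 1 k,
          (β j : ℂ) • xi m.contra (shift (dualEntries m p.val) j k (-d))) := by
  rw [← sum_Icc_flip k fun j =>
    (β j : ℂ) • xi m.contra (shift (dualEntries m p.val) j k (-d)), map_sum, Finset.smul_sum,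
    ← Finset.sum_neg_distrib]
  refine Finset.sum_congr rfl fun j hj => ?_
  rw [Finset.mem_Icc] at hj
  rw [map_smul, opJ_xi m (shift_eq_zero p.2 hj.1 hj.2 (by omega) d),
    entrySum_shift _ hj.1 hj.2 (by omega), dualEntries_shift m _ hj.1 hj.2 (by omega),
    hαβ j hj.1 hj.2, zpow_add₀ (by norm_num), hd, smul_smul, smul_smul, ← neg_smul]
  congr 1
  ring

theorem opJ_single {m m' : TopRow n} (h : m.contra = m') (p : Pattern m) :
    opJ h (Finsupp.single p 1)
      = ((-1 : ℂ) ^ entrySum n p.val) • Finsupp.single (dualPattern h p) 1 :=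
  onPatterns_single _ _

theorem opJ_opLower (m : TopRow n) {k : ℕ} (hk : k + 1 ≤ n) (v : GTSpace m) :
    opJ (rfl : m.contra = m.contra) (opLower m k v) = -opRaise m.contra k (opJ rfl v) := by
  have : opJ (rfl : m.contra = m.contra) ∘ₗ opLower m k
      = -(opRaise m.contra k ∘ₗ opJ (rfl : m.contra = m.contra)) := by
    refine eqOn_of_single fun p => ?_
    rw [LinearMap.comp_apply, LinearMap.neg_apply, LinearMap.comp_apply, opLower,
      onPatterns_single, opJ_single, map_smul, opRaise, onPatterns_single]
    exact opJ_sum_shift m p hk (-1) (by norm_num) _ _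
      fun j h1 h2 => raiseCoeff_dualEntries m p.val h1 h2 hk
  exact LinearMap.congr_fun this v

theorem opJ_opRaise (m : TopRow n) {k : ℕ} (hk : k + 1 ≤ n) (v : GTSpace m) :
    opJ (rfl : m.contra = m.contra) (opRaise m k v) = -opLower m.contra k (opJ rfl v) := by
  have : opJ (rfl : m.contra = m.contra) ∘ₗ opRaise m k
      = -(opLower m.contra k ∘ₗ opJ (rfl : m.contra = m.contra)) := by
    refine eqOn_of_single fun p => ?_
    rw [LinearMap.comp_apply, LinearMap.neg_apply, LinearMap.comp_apply, opRaise,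
      onPatterns_single, opJ_single, map_smul, opLower, onPatterns_single]
    exact opJ_sum_shift m p hk 1 (by norm_num) _ _
      fun j h1 h2 => lowerCoeff_dualEntries m p.2 h1 h2 hk
  exact LinearMap.congr_fun this v

/-- The extra scalar `m₁` appears because every entry is subtracted from `m₁` and row `k` has one
entry more than row `k - 1`. It disappears in `opJ_gtRep`, where it is multiplied by the trace of
`X`. -/
theorem opJ_opDiag (m : TopRow n) {k : ℕ} (hk1 : 1 ≤ k) (hk : k ≤ n) (v : GTSpace m) :
    opJ (rfl : m.contra = m.contra) (opDiag m k v)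
      = (m.row 1 : ℂ) • opJ rfl v - opDiag m.contra k (opJ rfl v) := by
  have : opJ (rfl : m.contra = m.contra) ∘ₗ opDiag m k
      = (m.row 1 : ℂ) • opJ rfl - opDiag m.contra k ∘ₗ opJ (rfl : m.contra = m.contra) := by
    refine eqOn_of_single fun p => ?_
    rw [LinearMap.comp_apply, LinearMap.sub_apply, LinearMap.comp_apply, LinearMap.smul_apply,
      opDiag, onPatterns_single, xi_val, map_smul, opJ_single, map_smul, opDiag,
      onPatterns_single, xi_val]
    change _ = _ - _ • ((rowSum (dualEntries m p.val) k - rowSum (dualEntries m p.val) (k - 1) : ℤ)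
      : ℂ) • _
    rw [rowSum_dualEntries m _ hk, rowSum_dualEntries m _ (show k - 1 ≤ n by omega),
      Nat.cast_sub hk1, smul_smul, smul_smul, smul_smul, ← sub_smul]
    congr 1
    push_cast
    ring
  exact LinearMap.congr_fun this v

/-- In a commutator the two minus signs cancel; the remaining one comes from the opposite order of
the factors in `opUp` and `opDown`. -/
theorem opJ_opUp (m : TopRow n) (k d : ℕ) (h : k + d + 1 ≤ n) (v : GTSpace m) :
    opJ (rfl : m.contra = m.contra) (opUp m k d v) = -opDown m.contra k d (opJ rfl v) := by
  induction d generalizing v with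
  | zero => exact opJ_opRaise m h v
  | succ d ih =>
    have ih := ih (by omega)
    simp only [opUp, opDown, LinearMap.sub_apply, Module.End.mul_apply, map_sub]
    rw [ih, opJ_opRaise m (by omega), opJ_opRaise m (by omega), ih, map_neg, map_neg]
    abel

theorem opJ_opDown (m : TopRow n) (k d : ℕ) (h : k + d + 1 ≤ n) (v : GTSpace m) :
    opJ (rfl : m.contra = m.contra) (opDown m k d v) = -opUp m.contra k d (opJ rfl v) := by
  induction d generalizing v with
  | zero => exact opJ_opLower m h v
  | succ d ih =>
    have ih := ih (by omega)
    simp only [opUp, opDown, LinearMap.sub_apply, Module.End.mul_apply, map_sub]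
    rw [ih, opJ_opLower m (by omega), opJ_opLower m (by omega), ih, map_neg, map_neg]
    abel

theorem opJ_opE (m : TopRow n) {k l : ℕ} (hk1 : 1 ≤ k) (hk : k ≤ n) (hl : l ≤ n)
    (v : GTSpace m) : opJ (rfl : m.contra = m.contra) (opE m k l v)
      = (if k = l then (m.row 1 : ℂ) else 0) • opJ rfl v - opE m.contra l k (opJ rfl v) := by
  rcases lt_trichotomy k l with h | h | h
  · rw [opE, if_pos h, opE, if_neg h.not_gt, if_pos h, if_neg h.ne, zero_smul, zero_sub,
      opJ_opUp m _ _ (by omega)]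
  · subst h
    rw [opE, opE, if_neg (lt_irrefl k), if_neg (lt_irrefl k), if_neg (lt_irrefl k),
      if_neg (lt_irrefl k), if_pos rfl, opJ_opDiag m hk1 hk]
  · rw [opE, if_neg h.not_gt, if_pos h, opE, if_pos h, if_neg h.ne', zero_smul, zero_sub,
      opJ_opDown m _ _ (by omega)]

theorem opJ_gtRep {m m' : TopRow n} (h : m.contra = m') (X : SL n) (v : GTSpace m) :
    opJ h (gtRep m X v) = gtRep m' (outI n X) (opJ h v) := by
  subst h
  have htr : ∑ k, X.val k k = 0 := X.property
  simp only [gtRep, LinearMap.sum_apply, LinearMap.smul_apply, map_sum, map_smul]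
  have h1 : ∀ k l : Fin n, X.val k l • opJ (rfl : m.contra = m.contra)
        (opE m (k + 1) (l + 1) v)
      = (if k = l then (X.val k k * m.row 1) • opJ (rfl : m.contra = m.contra) v else 0)
        + (outI n X).val l k • opE m.contra (l + 1) (k + 1) (opJ rfl v) := by
    intro k l
    have hkl : ((k : ℕ) + 1 = l + 1) ↔ k = l := by rw [add_left_inj, Fin.val_inj]
    rw [opJ_opE m (by omega) (by omega) (by omega), smul_sub, outI_val]
    simp only [hkl, Matrix.neg_apply, Matrix.transpose_apply, neg_smul, sub_eq_add_neg]
    congr 1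
    split_ifs with h
    · rw [h, smul_smul]
    · simp
  simp only [h1, Finset.sum_add_distrib, Finset.sum_ite_eq, Finset.mem_univ, if_true,
    ← Finset.sum_smul, ← Finset.sum_mul, htr, zero_mul, zero_smul, zero_add]
  exact Finset.sum_comm

theorem opJ_opJ {m m' : TopRow n} (h : m.contra = m') (h' : m'.contra = m) (v : GTSpace m) :
    opJ h' (opJ h v) = signJ m • v := by
  have : opJ h' ∘ₗ opJ h = signJ m • LinearMap.id := by
    refine eqOn_of_single fun p => ?_
    rw [LinearMap.comp_apply, opJ_single, map_smul, opJ_single, smul_smul,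
      ← zpow_add₀ (by norm_num)]
    have hp : dualPattern h' (dualPattern h p) = p := by
      apply Subtype.ext
      subst h
      exact dualEntries_dualEntries m p.2.eq_zero
    rw [hp]
    change (-1 : ℂ) ^ (entrySum n p.val + entrySum n (dualEntries m p.val)) • _ = _
    rw [entrySum_dualEntries, add_sub_cancel]
    rfl
  exact LinearMap.congr_fun this v

theorem signJ_mul_self (m : TopRow n) : signJ m * signJ m = 1 := by
  rw [signJ, ← mul_zpow]
  norm_num

theorem opJ_bijective {m m' : TopRow n} (h : m.contra = m') : Function.Bijective (opJ h) := by
  have h' : m'.contra = m := by rw [← h, m.contra_contra]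
  constructor
  · intro u v huv
    have := congrArg (opJ h') huv
    rw [opJ_opJ h h', opJ_opJ h h'] at this
    have := congrArg (signJ m • ·) this
    simpa only [smul_smul, signJ_mul_self, one_smul] using this
  · intro v
    refine ⟨opJ h' (signJ m' • v), ?_⟩
    rw [opJ_opJ h' h, smul_smul, signJ_mul_self, one_smul]

theorem opJ_sq {m : TopRow n} (h : m.contra = m) :
    opJ h ^ 2 = signJ m • (1 : Module.End ℂ (GTSpace m)) := by
  ext1 p
  ext1
  rw [pow_two]
  exact opJ_opJ h h _

theorem isSimulationMatrix_opJ {m : TopRow n} (h : m.contra = m) {c : ℂ} (hc : c ^ 2 = signJ m) :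
    IsSimulationMatrix (gtRep m) (outI n) (c • opJ h) := by
  constructor
  · rw [smul_pow, opJ_sq, hc, smul_smul, signJ_mul_self, one_smul]
  · intro X
    rw [mul_smul_comm, smul_mul_assoc]
    congr 1
    refine LinearMap.ext fun v => ?_
    exact (opJ_gtRep h X v).symm

end GelfandTseitlin

/-! ### Comparison of highest weights -/

section Weights

variable {n : ℕ}

/-- The coweight `diag(1, …, 1, 0, …, 0)` with `p` ones, made traceless. -/
def coweight (n p : ℕ) (hp : p ≤ n) : SL n :=
  ⟨Matrix.diagonal fun k : Fin n => (if (k : ℕ) < p then (1 : ℂ) else 0) - p / n, by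
    change Matrix.trace (Matrix.diagonal
      fun k : Fin n => (if (k : ℕ) < p then (1 : ℂ) else 0) - p / n) = 0
    rw [Matrix.trace_diagonal, Finset.sum_sub_distrib,
      Fin.sum_univ_eq_sum_range (fun k => if k < p then (1 : ℂ) else 0), ← Finset.sum_filter]
    have hf : (Finset.range n).filter (fun k => k < p) = Finset.range p := by
      ext k; simp; omega
    rw [hf]
    rcases Nat.eq_zero_or_pos n with rfl | h
    · simp; omega
    · have : (n : ℂ) ≠ 0 := by exact_mod_cast h.ne'
      simp [mul_div_cancel₀ _ this]⟩

theorem gtRep_diagonal_single (m : TopRow n) {X : SL n} (hX : X.val.IsDiag) (q : Pattern m) :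
    gtRep m X (Finsupp.single q 1)
      = (∑ k : Fin n, X.val k k * ((rowSum q.val (k + 1) - rowSum q.val k : ℤ) : ℂ))
        • Finsupp.single q 1 := by
  simp only [gtRep, LinearMap.sum_apply, LinearMap.smul_apply, Finset.sum_smul]
  refine Finset.sum_congr rfl fun k _ => ?_
  rw [Finset.sum_eq_single k]
  · rw [opE, if_neg (lt_irrefl _), if_neg (lt_irrefl _), opDiag, onPatterns_single, xi_val,
      smul_smul, Nat.add_sub_cancel]
  · intro l _ hl
    rw [hX (Ne.symm hl), zero_smul]
  · simp

/-- The eigenvalue of the coweight on a basis vector. -/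
def coweightEigenvalue {m : TopRow n} (p : ℕ) (q : Pattern m) : ℝ :=
  rowSum q.val p - p / n * rowSum q.val n

theorem gtRep_coweight_single (m : TopRow n) {p : ℕ} (hp : p ≤ n) (q : Pattern m) :
    gtRep m (coweight n p hp) (Finsupp.single q 1)
      = (coweightEigenvalue p q : ℂ) • Finsupp.single q 1 := by
  rw [gtRep_diagonal_single m (Matrix.isDiag_diagonal _)]
  congr 1
  have h1 : ∀ k : Fin n, (coweight n p hp).val k k
      = (if (k : ℕ) < p then (1 : ℂ) else 0) - p / n := fun k => Matrix.diagonal_apply_eq _ _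
  have hr0 : rowSum q.val 0 = 0 := by simp [rowSum]
  have tele : ∀ N, ∑ k ∈ Finset.range N,
      ((rowSum q.val (k + 1) - rowSum q.val k : ℤ) : ℂ) = rowSum q.val N := by
    intro N
    rw [← Int.cast_sum, Finset.sum_range_sub, hr0, sub_zero]
  simp only [h1, sub_mul, Finset.sum_sub_distrib, ← Finset.mul_sum]
  rw [Fin.sum_univ_eq_sum_range (fun k => ((rowSum q.val (k + 1) - rowSum q.val k : ℤ) : ℂ)),
    Fin.sum_univ_eq_sum_range (fun k => (if k < p then (1 : ℂ) else 0) *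
      ((rowSum q.val (k + 1) - rowSum q.val k : ℤ) : ℂ)), tele]
  simp only [ite_mul, one_mul, zero_mul, ← Finset.sum_filter]
  have hf : (Finset.range n).filter (fun k => k < p) = Finset.range p := by
    ext k; simp; omega
  rw [hf, tele, coweightEigenvalue]
  push_cast
  rfl

theorem gtRep_coweight_apply (m : TopRow n) {p : ℕ} (hp : p ≤ n) (v : GTSpace m)
    (q : Pattern m) : gtRep m (coweight n p hp) v q = (coweightEigenvalue p q : ℂ) * v q := by
  have : Finsupp.lapply q ∘ₗ gtRep m (coweight n p hp)
      = (coweightEigenvalue p q : ℂ) • (Finsupp.lapply q : GTSpace m →ₗ[ℂ] ℂ) := by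
    refine eqOn_of_single fun r => ?_
    rw [LinearMap.comp_apply, gtRep_coweight_single, map_smul, LinearMap.smul_apply]
    by_cases hr : r = q
    · rw [hr]
    · simp [hr]
  exact LinearMap.congr_fun this v

/-- The pattern with all entries as large as possible. -/
def maxPattern (m : TopRow n) : Pattern m :=
  ⟨fun i j => if 1 ≤ i ∧ i ≤ j ∧ j ≤ n then m.row i else 0, by
    constructor
    · exact fun i j h => if_neg h
    · exact fun i h1 h2 => if_pos ⟨h1, h2, le_rfl⟩
    · intro i j h1 h2 h3
      rw [if_pos ⟨h1, h2, by omega⟩, if_pos ⟨h1, by omega, h3⟩]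
    · intro i j h1 h2 h3
      rw [if_pos ⟨by omega, by omega, h3⟩, if_pos ⟨h1, h2, by omega⟩]
      exact m.row_succ_le i h1 (by omega)⟩

theorem rowSum_maxPattern (m : TopRow n) {p : ℕ} (hp : p ≤ n) :
    rowSum (maxPattern m).val p = ∑ i ∈ Finset.Icc 1 p, m.row i :=
  Finset.sum_congr rfl fun i hi => by
    rw [Finset.mem_Icc] at hi
    exact if_pos ⟨hi.1, hi.2, hp⟩

theorem Pattern.le_row {m : TopRow n} (q : Pattern m) {i j : ℕ} (hi : 1 ≤ i) (hij : i ≤ j)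
    (hj : j ≤ n) : q.val i j ≤ m.row i := by
  obtain ⟨d, hd⟩ := Nat.exists_eq_add_of_le hj
  induction d generalizing j with
  | zero =>
    obtain rfl : j = n := by omega
    exact (q.2.top i hi hij).le
  | succ d ih =>
    exact (q.2.le_left i j hi hij (by omega)).trans (ih (by omega) (by omega) (by omega))

theorem rowSum_le (m : TopRow n) (q : Pattern m) {p : ℕ} (hp : p ≤ n) :
    rowSum q.val p ≤ ∑ i ∈ Finset.Icc 1 p, m.row i :=
  Finset.sum_le_sum fun i hi => by
    rw [Finset.mem_Icc] at hi
    exact q.le_row hi.1 hi.2 hp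

theorem rowSum_top {m : TopRow n} (q : Pattern m) :
    rowSum q.val n = ∑ i ∈ Finset.Icc 1 n, m.row i :=
  Finset.sum_congr rfl fun i hi => by
    rw [Finset.mem_Icc] at hi
    exact q.2.top i hi.1 hi.2

/-- The left side is the eigenvalue of the coweight on `maxPattern m`. Any pattern in the support of
the image vector has the same eigenvalue, and its row sum is at most the partial sum of `m'`. -/
theorem partialSum_le_of_equiv {m m' : TopRow n} (ψ : GTSpace m ≃ₗ[ℂ] GTSpace m')
    (hψ : ∀ X v, ψ (gtRep m X v) = gtRep m' X (ψ v)) {p : ℕ} (hp : p ≤ n) :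
    ((∑ i ∈ Finset.Icc 1 p, m.row i : ℤ) : ℝ) - p / n * (∑ i ∈ Finset.Icc 1 n, m.row i : ℤ)
      ≤ (∑ i ∈ Finset.Icc 1 p, m'.row i : ℤ) - p / n * (∑ i ∈ Finset.Icc 1 n, m'.row i : ℤ) := by
  set v : GTSpace m := Finsupp.single (maxPattern m) 1 with hv
  have hne : ψ v ≠ 0 := by
    rw [Ne, LinearEquiv.map_eq_zero_iff, hv, Finsupp.single_eq_zero]
    exact one_ne_zero
  obtain ⟨q, hq⟩ := Finsupp.ne_iff.mp hne
  have h1 := hψ (coweight n p hp) v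
  rw [gtRep_coweight_single m hp, map_smul] at h1
  have h2 := congrArg (fun w => w q) h1
  simp only [Finsupp.smul_apply, smul_eq_mul] at h2
  rw [gtRep_coweight_apply] at h2
  have h3 : coweightEigenvalue p (maxPattern m) = coweightEigenvalue p q := by
    exact_mod_cast mul_right_cancel₀ hq h2
  rw [coweightEigenvalue, coweightEigenvalue, rowSum_top, rowSum_top, rowSum_maxPattern m hp] at h3
  rw [h3]
  have : (rowSum q.val p : ℝ) ≤ (∑ i ∈ Finset.Icc 1 p, m'.row i : ℤ) := by
    exact_mod_cast rowSum_le m' q hp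
  linarith

/-- The inequality for `ψ` and for its inverse gives equality, and successive differences show that
the rows agree up to a constant. The normalisation `m_n = 0` fixes the constant. -/
theorem topRow_eq_of_equiv {m m' : TopRow n} (ψ : GTSpace m ≃ₗ[ℂ] GTSpace m')
    (hψ : ∀ X v, ψ (gtRep m X v) = gtRep m' X (ψ v)) : m = m' := by
  have hψ' : ∀ X v, ψ.symm (gtRep m' X v) = gtRep m X (ψ.symm v) := fun X v =>
    ψ.injective (by simp [hψ])
  have heq : ∀ p, p ≤ n →
      ((∑ i ∈ Finset.Icc 1 p, m.row i : ℤ) : ℝ) - p / n * (∑ i ∈ Finset.Icc 1 n, m.row i : ℤ)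
      = (∑ i ∈ Finset.Icc 1 p, m'.row i : ℤ) - p / n * (∑ i ∈ Finset.Icc 1 n, m'.row i : ℤ) :=
    fun p hp => le_antisymm (partialSum_le_of_equiv ψ hψ hp) (partialSum_le_of_equiv ψ.symm hψ' hp)
  set R := ∑ i ∈ Finset.Icc 1 n, m.row i
  set R' := ∑ i ∈ Finset.Icc 1 n, m'.row i
  have hdiff : ∀ p, p + 1 ≤ n →
      (m.row (p + 1) : ℝ) - R / n = (m'.row (p + 1) : ℝ) - R' / n := by
    intro p hp
    have h1 := heq (p + 1) hp
    have h0 := heq p (by omega)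
    rw [Finset.sum_Icc_succ_top (by omega), Finset.sum_Icc_succ_top (by omega)] at h1
    push_cast at h1 h0
    linear_combination h1 - h0
  ext i
  by_cases hi : 1 ≤ i ∧ i ≤ n
  · have hn := hdiff (n - 1) (by omega)
    have h1 := hdiff (i - 1) (by omega)
    rw [show n - 1 + 1 = n by omega, m.row_last, m'.row_last] at hn
    rw [show i - 1 + 1 = i by omega] at h1
    have : (m.row i : ℝ) = m'.row i := by push_cast at hn; linarith
    exact_mod_cast this
  · rw [m.row_eq_zero i hi, m'.row_eq_zero i hi]

variable {V : Type*} [AddCommGroup V] [Module ℂ V] [LieRingModule (SL n) V]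
    [LieModule ℂ (SL n) V]

theorem selfContragredient_iff_intertwined_outI [FiniteDimensional ℂ V]
    [LieModule.IsIrreducible ℂ (SL n) V] : SelfContragredient (SL n) V ↔
      Intertwined (actionMap V ∘ₗ ((outI n).toLinearEquiv : SL n →ₗ[ℂ] SL n)) (actionMap V) := by
  have h := intertwined_outI_dual (isLieRep_actionMap (L := SL n) V) (isIrred_actionMap V)
  rw [selfContragredient_iff]
  exact ⟨fun hs => h.trans hs.symm, fun hs => hs.symm.trans h⟩

/-- `J ∘ φ` identifies the twist of `V` with `r(m')`. An equivalence of `V` with its twist thus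
makes `r(m)` and `r(m')` equivalent, which the top rows detect; conversely `J` itself gives the
equivalence. -/
theorem intertwined_outI_iff_contra_eq {m : TopRow n} {φ : V ≃ₗ[ℂ] GTSpace m}
    (hφ : IsGTEquivalence m φ) :
    Intertwined (actionMap V ∘ₗ ((outI n).toLinearEquiv : SL n →ₗ[ℂ] SL n)) (actionMap V) ↔
      m.contra = m := by
  have key : ∀ {m'} (h : m.contra = m') (X : SL n) (v : V),
      opJ h (φ ⁅outI n X, v⁆) = gtRep m' X (opJ h (φ v)) := fun h X v => by
    rw [hφ, opJ_gtRep, outI_outI]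
  constructor
  · rintro ⟨e, he⟩
    have he' : ∀ X v, e ⁅outI n X, v⁆ = ⁅X, e v⁆ := he
    let Jφ := φ.trans (LinearEquiv.ofBijective (opJ rfl) (opJ_bijective (rfl : m.contra = _)))
    refine (topRow_eq_of_equiv (φ.symm.trans (e.symm.trans Jφ)) fun X v => ?_).symm
    obtain ⟨u, rfl⟩ := φ.surjective v
    obtain ⟨w, rfl⟩ := e.surjective u
    rw [← hφ, ← he']
    simp only [LinearEquiv.trans_apply, LinearEquiv.symm_apply_apply]
    exact key rfl X w
  · intro h
    let J := LinearEquiv.ofBijective (opJ h) (opJ_bijective h)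
    refine ⟨φ.trans (J.trans φ.symm), fun X v => φ.injective ?_⟩
    have h2 := key h X v
    change φ (φ.symm (opJ h (φ ⁅outI n X, v⁆))) = φ ⁅X, φ.symm (opJ h (φ v))⁆
    rw [h2, LinearEquiv.apply_symm_apply, hφ, LinearEquiv.apply_symm_apply]

theorem IsSimulationMatrix.conj {m : TopRow n} {φ : V ≃ₗ[ℂ] GTSpace m}
    (hφ : IsGTEquivalence m φ) {g : SL n ≃ₗ⁅ℂ⁆ SL n} {R : Module.End ℂ (GTSpace m)}
    (hR : IsSimulationMatrix (gtRep m) g R) :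
    IsSimulationMatrix (fun X => LieModule.toEnd ℂ (SL n) V X) g (φ.symm.conj R) := by
  constructor
  · refine LinearMap.ext fun v => φ.injective ?_
    have := LinearMap.congr_fun hR.1 (φ v)
    rw [pow_two] at this ⊢
    simpa [LinearEquiv.conj_apply] using this
  · intro X
    refine LinearMap.ext fun v => φ.injective ?_
    have := LinearMap.congr_fun (hR.2 X) (φ v)
    have e1 : ∀ w, φ (LieModule.toEnd ℂ (SL n) V (g X) w) = gtRep m (g X) (φ w) := fun w =>
      hφ (g X) w
    have e2 : φ (LieModule.toEnd ℂ (SL n) V X v) = gtRep m X (φ v) := hφ X v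
    simp only [Module.End.mul_apply, LinearEquiv.conj_apply, LinearMap.comp_apply,
      LinearEquiv.coe_coe, LinearEquiv.symm_symm, e1, e2, LinearEquiv.apply_symm_apply] at this ⊢
    exact this

end Weights

end SlGrading

end

open SlGrading in
theorem theorem3 (n : ℕ) (V : Type*) [AddCommGroup V] [Module ℂ V] [LieRingModule (SL n) V]
    [LieModule ℂ (SL n) V] [FiniteDimensional ℂ V] [LieModule.IsIrreducible ℂ (SL n) V] :
    -- compatibility criterion, for every outer automorphism of order two
    (∀ g : SL n ≃ₗ⁅ℂ⁆ SL n, IsOuter g → HasOrderTwo g →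
      (Compatible (z2Grading g) V ↔ SelfContragredient (SL n) V)) ∧
    -- the same for `X ↦ -Xᵀ`, for every `n`
    (Compatible (z2Grading (outI n)) V ↔ SelfContragredient (SL n) V) ∧
    -- `J` intertwines `r(m)`, twisted by `X ↦ -Xᵀ`, with the contragredient `r(m')`
    (∀ (m m' : TopRow n) (h : m.contra = m'), Function.Bijective (opJ h) ∧
      ∀ X : SL n, opJ h ∘ₗ gtRep m X = gtRep m' (outI n X) ∘ₗ opJ h) ∧
    -- if `m' = m`, then `J`, normalized, is a simulation matrix of `X ↦ -Xᵀ` for `r(m)`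
    (∀ (m : TopRow n) (h : m.contra = m), (opJ h) ^ 2 = signJ m • (1 : Module.End ℂ (GTSpace m)) ∧
      ∀ c : ℂ, c ^ 2 = signJ m → IsSimulationMatrix (gtRep m) (outI n) (c • opJ h)) ∧
    -- if `V` is equivalent to `r(m)`, it is self-contragredient iff `m' = m`, and then `J`,
    -- normalized and carried over to `V`, is a simulation matrix for `V`
    (∀ (m : TopRow n) (φ : V ≃ₗ[ℂ] GTSpace m), IsGTEquivalence m φ →
      (SelfContragredient (SL n) V ↔ m.contra = m) ∧
      ∀ h : m.contra = m, ∀ c : ℂ, c ^ 2 = signJ m →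
        IsSimulationMatrix (fun X => LieModule.toEnd ℂ (SL n) V X) (outI n)
          (φ.symm.conj (c • opJ h))) := by
  refine ⟨fun g hg ho => ?_, ?_, fun m m' h => ⟨opJ_bijective h, fun X => ?_⟩,
    fun m h => ⟨opJ_sq h, fun c hc => isSimulationMatrix_opJ h hc⟩, fun m φ hφ => ⟨?_, ?_⟩⟩
  · rw [compatible_iff_intertwined V g fun x => DFunLike.congr_fun ho.2 x, selfContragredient_iff]
    have h := intertwined_outer_dual (isLieRep_actionMap (L := SL n) V) (isIrred_actionMap V) hg
    exact ⟨fun hs => hs.symm.trans h, fun hs => h.trans hs.symm⟩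
  -- For `n ≤ 2` the map `X ↦ -Xᵀ` is inner, so the outer case does not cover it; the comparison of
  -- lowest weights works for every `n`.
  · rw [compatible_iff_intertwined V (outI n) outI_outI, selfContragredient_iff_intertwined_outI]
  · exact LinearMap.ext fun v => opJ_gtRep h X v
  · rw [selfContragredient_iff_intertwined_outI, intertwined_outI_iff_contra_eq hφ]
  · exact fun h c hc => (isSimulationMatrix_opJ h hc).conj hφ
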